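/- "Computable" refers to Kleene's schemes S1-S9 over the total functionals of finite type over $\mathbb{N}$, where the functionals given as oracles, and the functionals computed, may be partial functions of their (total) arguments. Reals are given by names: sequences of rationals $(q_n)$ with $|q_n-q_m|<2^{-n}$ for $n<m$ (every element of $\mathbb{N}^{\mathbb{N}}$ is turned into such a sequence by freezing it as soon as the condition is about to fail). A function $f:[0,1]\to\mathbb{R}$ is given by a functional of type $1\to1$ that sends every name of $x\in[0,1]$ to a name of $f(x)$, and a set $X\subset\mathbb{R}$ by its characteristic function. Kleene's quantifier is the functional $\exists^2:\mathbb{N}^{\mathbb{N}}\to\{0,1\}$ with $\exists^2(f)=0\leftrightarrow(\exists n)(f(n)=0)$. For $f:[0,1]\to\mathbb{R}$, the oscillation function is $$\mathsf{osc}_f(x)=\lim_{k\to\infty}\Big(\sup_{y\in B(x,2^{-k})\cap[0,1]}f(y)-\inf_{y\in B(x,2^{-k})\cap[0,1]}f(y)\Big).$$ When it is real-valued, put $D_n=\{x\in[0,1]:\mathsf{osc}_f(x)\ge 2^{-n}\}$. For an open set $O\subseteq[0,1]$ (relative topology): - an R2-representation of $O$ is a function $Y:[0,1]\to[0,1]$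 such that $O=\{x: Y(x)>0\}$, and $(x-Y(x),x+Y(x))\cap[0,1]\subseteq O$ whenever $Y(x)>0$; - an R3-representation of $O$ is a continuous function $Y:[0,1]\to[0,1]$ such that $Y(x)$ is the distance from $x$ to $[0,1]\setminus O$ if the latter is non-empty, and $Y$ is constantly $1$ if $O=[0,1]$. Consider the following specifications of possibly partial functionals. - (A) A functional $\Gamma$ that, on input (representations of) a function $f:[0,1]\to\mathbb{R}$ of Baire class 1, its real-valued oscillation function $\mathsf{osc}_f:[0,1]\to\mathbb{R}$, and $n\in\mathbb{N}$, outputs an R2-representation of $[0,1]\setminus D_n$. - ($\Delta$) A functional $\Delta$ that, on input any R2-representation of any open $O\subseteq[0,1]$, outputs an R3-representation of $O$. - (Baire realiser) A functional $\xi$ that, on input any sequence $(O_n)_{n\in\mathbb{N}}$ of dense open subsets of $\mathbb{R}$, outputs a real $\xi((O_n)_n)\in\bigcap_{n}O_n$. - (Finiteness realiser) A functional $\Omega_{\mathsf{fin}}$ that, on input any finite set $X\subset\mathbb{R}$, outputs a finite sequence of reals that includes all elements of $X$. **Theorem 3.3.** 1. There is an S1-S9 index $e$ such that, for every $\Gamma$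 satisfying (A), the functional $\{e\}(\exists^2,\Gamma)$ is a Baire realiser. 2. There is an S1-S9 index $d$ such that, for every $\Gamma$ satisfying (A) and every $\Delta$ satisfying ($\Delta$), the functional $\{d\}(\exists^2,\Gamma,\Delta)$ is a finiteness realiser. -/

import Mathlib

/-!  Kleene's higher-order computability (schemes S1-S9) over the full type structure of total
functionals of finite type over the natural numbers, representations of reals, of real functions
and of open sets, and the specifications of the functionals under consideration. -/

noncomputable section

namespace HigherOrder

/-! ### Finite types and functionals -/

/-- The finite types: the type `0` of natural numbers, and `σ → τ`. -/
inductive FinType : Type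
  | zero : FinType
  | arrow (σ τ : FinType) : FinType

/-- The total objects of a finite type: `ℕ` at type `0`, and all functions at type `σ → τ`. -/
def Obj : FinType → Type
  | .zero => ℕ
  | .arrow σ τ => Obj σ → Obj τ

/-- The possibly partial functionals of type `σ₁ → … → σₖ → 0`: they take total objects as
arguments, and their value (a natural number) may be undefined. -/
def PObj : FinType → Type
  | .zero => Part ℕ
  | .arrow σ τ => Obj σ → PObj τ

/-- A total object, seen as a functional that happens to be defined everywhere. -/
def Obj.toPObj : (σ : FinType) → Obj σ → PObj σ
  | .zero, x => (Part.some x : Part ℕ)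
  | .arrow _ τ, F => fun a => Obj.toPObj τ (F a)

/-- The arguments of a computation: natural numbers, and possibly partial functionals. -/
inductive Arg : Type
  | num (x : ℕ) : Arg
  | fn (σ τ : FinType) (F : PObj (.arrow σ τ)) : Arg

/-- A total object as an argument of a computation. -/
def Arg.ofObj : (σ : FinType) → Obj σ → Arg
  | .zero, x => .num x
  | .arrow σ τ, F => .fn σ τ (Obj.toPObj (.arrow σ τ) F)

/-! ### Kleene's schemes S1-S9 -/

/-- Indices (programs) for the schemes S1-S9. -/
inductive Index : Type
  | S1 : Index
  | S2 (q : ℕ) : Index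
  | S3 : Index
  | S4 (e₁ e₂ : Index) : Index
  | S5 (e₁ e₂ : Index) : Index
  | S6 (π : List ℕ) (e : Index) : Index
  | S7 : Index
  | S8 (k : ℕ) (d : Fin k → Index) : Index
  | S9 (m : ℕ) : Index

/-- The Gödel number of an index. -/
def Index.code : Index → ℕ
  | .S1 => Nat.pair 1 0
  | .S2 q => Nat.pair 2 q
  | .S3 => Nat.pair 3 0
  | .S4 e₁ e₂ => Nat.pair 4 (Nat.pair e₁.code e₂.code)
  | .S5 e₁ e₂ => Nat.pair 5 (Nat.pair e₁.code e₂.code)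
  | .S6 π e => Nat.pair 6 (Nat.pair (Encodable.encode π) e.code)
  | .S7 => Nat.pair 7 0
  | .S8 _ d => Nat.pair 8 (Encodable.encode (List.ofFn fun i => (d i).code))
  | .S9 m => Nat.pair 9 m

mutual

/-- `Computes e Φ n` : the computation `{e}(Φ)` terminates with value `n`.
* S1: `{e}(x, Φ) = x + 1`, S2: `{e}(Φ) = q`, S3: `{e}(x, Φ) = x`.
* S4 (composition): `{e}(Φ) = {e₁}({e₂}(Φ), Φ)`.
* S5 (primitive recursion): `{e}(0, Φ) = {e₁}(Φ)` and `{e}(x + 1, Φ) = {e₂}(x, {e}(x, Φ), Φ)`.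
* S6 (rearranging arguments): `{e}(Φ) = {e'}(Φ_{π 0}, …, Φ_{π (l-1)})`.
* S7 (function application): `{e}(f, x, Φ) = f(x)`.
* S8 (functional application): `{e}(F, Φ) = F(λ y. {d₀}(y, F, Φ), …, λ y. {dₖ₋₁}(y, F, Φ))`,
  provided that these `k` functionals are total.
* S9 (universal computation): `{e}(d, Φ) = {d}(Φ₀, …, Φ_{m-1})`. -/
inductive Computes : Index → List Arg → ℕ → Prop
  | S1 (x : ℕ) (Φ : List Arg) : Computes .S1 (.num x :: Φ) (x + 1)
  | S2 (q : ℕ) (Φ : List Arg) : Computes (.S2 q) Φ q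
  | S3 (x : ℕ) (Φ : List Arg) : Computes .S3 (.num x :: Φ) x
  | S4 (e₁ e₂ : Index) (Φ : List Arg) (m n : ℕ) :
      Computes e₂ Φ m → Computes e₁ (.num m :: Φ) n → Computes (.S4 e₁ e₂) Φ n
  | S5_zero (e₁ e₂ : Index) (Φ : List Arg) (n : ℕ) :
      Computes e₁ Φ n → Computes (.S5 e₁ e₂) (.num 0 :: Φ) n
  | S5_succ (e₁ e₂ : Index) (Φ : List Arg) (x m n : ℕ) :
      Computes (.S5 e₁ e₂) (.num x :: Φ) m → Computes e₂ (.num x :: .num m :: Φ) n →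
        Computes (.S5 e₁ e₂) (.num (x + 1) :: Φ) n
  | S6 (π : List ℕ) (e : Index) (Φ Ψ : List Arg) (n : ℕ) :
      (π.map fun i => Φ[i]?) = Ψ.map some → Computes e Ψ n → Computes (.S6 π e) Φ n
  | S7 (f : ℕ → Part ℕ) (x : ℕ) (Φ : List Arg) (n : ℕ) :
      n ∈ f x → Computes .S7 (.fn .zero .zero f :: .num x :: Φ) n
  | S8 (k : ℕ) (d : Fin k → Index) (σ τ : FinType) (F : PObj (.arrow σ τ)) (Φ : List Arg)
      (n : ℕ) :
      Applies (List.ofFn d) (.arrow σ τ) F (.fn σ τ F :: Φ) n →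
        Computes (.S8 k d) (.fn σ τ F :: Φ) n
  | S9 (m : ℕ) (e : Index) (Φ : List Arg) (n : ℕ) :
      m ≤ Φ.length → Computes e (Φ.take m) n → Computes (.S9 m) (.num e.code :: Φ) n

/-- `Applies [d₀, …, dₖ₋₁] σ F Φ n` : the functional `F` of type `σ = σ₀ → … → σₖ₋₁ → 0` has value
`n` at the arguments `λ y. {dᵢ}(y, Φ)`, which are total. -/
inductive Applies : List Index → (σ : FinType) → PObj σ → List Arg → ℕ → Prop
  | nil (F : Part ℕ) (Φ : List Arg) (n : ℕ) : n ∈ F → Applies [] .zero F Φ n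
  | cons (d : Index) (ds : List Index) (σ τ : FinType) (F : Obj σ → PObj τ) (Φ : List Arg)
      (a : Obj σ) (n : ℕ) :
      Abstracts d σ Φ a → Applies ds τ (F a) Φ n → Applies (d :: ds) (.arrow σ τ) F Φ n

/-- `Abstracts d σ Φ a` : the functional `λ y₁ … yₘ. {d}(yₘ, …, y₁, Φ)` of type `σ` is total and
equal to `a`; here `y₁, …, yₘ` run over all total objects of the argument types of `σ`. -/
inductive Abstracts : Index → (σ : FinType) → List Arg → Obj σ → Prop
  | zero (d : Index) (Φ : List Arg) (x : ℕ) : Computes d Φ x → Abstracts d .zero Φ x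
  | arrow (d : Index) (σ τ : FinType) (Φ : List Arg) (G : Obj σ → Obj τ) :
      (∀ y : Obj σ, Abstracts d τ (Arg.ofObj σ y :: Φ) (G y)) → Abstracts d (.arrow σ τ) Φ G

end

theorem Index.code_injective : Function.Injective Index.code := by
  intro e
  induction e with
  | S4 a b iha ihb =>
    intro e' h
    cases e' <;> simp only [Index.code, Nat.pair_eq_pair] at h <;> first | omega | skip
    rw [iha h.2.1, ihb h.2.2]
  | S5 a b iha ihb =>
    intro e' h
    cases e' <;> simp only [Index.code, Nat.pair_eq_pair] at h <;> first | omega | skip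
    rw [iha h.2.1, ihb h.2.2]
  | S6 π a ih =>
    intro e' h
    cases e' <;> simp only [Index.code, Nat.pair_eq_pair] at h <;> first | omega | skip
    rw [ih h.2.2, Encodable.encode_injective h.2.1]
  | S8 k d ih =>
    intro e' h
    cases e' <;> simp only [Index.code, Nat.pair_eq_pair] at h <;> first | omega | skip
    rename_i k' d'
    have h2 := Encodable.encode_injective h.2
    have hk : k = k' := by simpa using congrArg List.length h2
    subst hk
    have h3 := List.ofFn_injective h2
    congr 1
    funext i
    exact ih i (congrFun h3 i)
  | _ =>
    intro e' h
    cases e' <;> simp only [Index.code, Nat.pair_eq_pair] at h <;> first | omega | simp_all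

/-- Computations are deterministic. -/
theorem Computes.unique {e : Index} {Φ : List Arg} {n m : ℕ} (h : Computes e Φ n)
    (h' : Computes e Φ m) : n = m := by
  refine Computes.rec (motive_1 := fun e Φ n _ => ∀ m, Computes e Φ m → n = m)
    (motive_2 := fun ds σ F Φ n _ => ∀ m, Applies ds σ F Φ m → n = m)
    (motive_3 := fun d σ Φ a _ => ∀ b, Abstracts d σ Φ b → a = b)
    ?_ ?_ ?_ ?_ ?_ ?_ ?_ ?_ ?_ ?_ ?_ ?_ ?_ ?_ h m h'
  · intro x Φ m h; cases h; rfl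
  · intro q Φ m h; cases h; rfl
  · intro q Φ m h; cases h; rfl
  · intro e₁ e₂ Φ a n _ _ ih1 ih2 m h
    cases h with
    | S4 _ _ _ a' _ h1 h2 => cases ih1 _ h1; exact ih2 _ h2
  · intro e₁ e₂ Φ n _ ih m h
    cases h with
    | S5_zero _ _ _ _ h1 => exact ih _ h1
  · intro e₁ e₂ Φ x a n _ _ ih1 ih2 m h
    cases h with
    | S5_succ _ _ _ _ a' _ h1 h2 => cases ih1 _ h1; exact ih2 _ h2
  · intro π e Φ Ψ n hΨ _ ih m h
    cases h with
    | S6 _ _ _ Ψ' _ hΨ' h1 =>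
      have : Ψ = Ψ' := List.map_injective_iff.2 (Option.some_injective _) (hΨ.symm.trans hΨ')
      subst this
      exact ih _ h1
  · intro f x Φ n hn m h
    cases h with
    | S7 _ _ _ _ hm => exact Part.mem_unique hn hm
  · intro k d σ τ F Φ n _ ih m h
    cases h with
    | S8 _ _ _ _ _ _ _ h1 => exact ih _ h1
  · intro a e Φ n _ _ ih m h
    generalize hc : e.code = c at h
    cases h with
    | S9 _ e' _ _ _ h1 => cases Index.code_injective hc; exact ih _ h1
  · intro F Φ n hn m h
    cases h with
    | nil _ _ _ hm => exact Part.mem_unique hn hm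
  · intro d ds σ τ F Φ a n _ _ ih1 ih2 m h
    cases h with
    | cons _ _ _ _ _ _ a' _ h1 h2 => cases ih1 _ h1; exact ih2 _ h2
  · intro d Φ x _ ih b h
    cases h with
    | zero _ _ _ h1 => exact ih _ h1
  · intro d σ τ Φ G _ ih b h
    cases h with
    | arrow _ _ _ _ G' h1 => funext y; exact ih y _ (h1 y)

/-- The value `{e}(Φ)`, defined if and only if the computation terminates. -/
def run (e : Index) (Φ : List Arg) : Part ℕ :=
  ⟨∃ n, Computes e Φ n, fun h => h.choose⟩

theorem mem_run {e : Index} {Φ : List Arg} {n : ℕ} : n ∈ run e Φ ↔ Computes e Φ n := by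
  constructor
  · rintro ⟨h, rfl⟩
    exact h.choose_spec
  · intro h
    have h' : ∃ n, Computes e Φ n := ⟨n, h⟩
    exact ⟨h', Computes.unique h'.choose_spec h⟩

/-- The possibly partial functional `λ y₁ … yₘ. {e}(yₘ, …, y₁, Φ)` of type `σ` that the index `e`
computes from the functionals `Φ`; the order of the arguments is immaterial, by S6. -/
def computed (e : Index) : (σ : FinType) → List Arg → PObj σ
  | .zero, Φ => run e Φ
  | .arrow σ τ, Φ => fun y => computed e τ (Arg.ofObj σ y :: Φ)

/-- Kleene's quantifier `∃²`. -/
def existsTwo : (ℕ → ℕ) → ℕ :=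
  open Classical in fun f => if ∃ n, f n = 0 then 0 else 1

/-! ### Real numbers and real functions -/

/-- Every natural number codes a rational number, a signed quotient of natural numbers. -/
def ratOf (c : ℕ) : ℚ :=
  ((c.unpair.1.unpair.1 : ℚ) - (c.unpair.1.unpair.2 : ℚ)) / ((c.unpair.2 : ℚ) + 1)

/-- The first `N + 1` terms of `q` do not violate the condition `|qᵢ - qⱼ| < 2⁻ⁱ` for `i < j`. -/
def FastUpTo (q : ℕ → ℚ) (N : ℕ) : Prop :=
  ∀ j ≤ N, ∀ i < j, |q i - q j| < 1 / 2 ^ i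

open Classical in
/-- The hat function: a sequence of rationals is frozen as soon as it is about to violate the
condition of fast convergence, and it is left unchanged if that never happens. -/
def hat (q : ℕ → ℚ) : ℕ → ℚ
  | 0 => q 0
  | N + 1 => if FastUpTo q (N + 1) then q (N + 1) else hat q N

theorem hat_eq_self {q : ℕ → ℚ} (N : ℕ) (h : FastUpTo q N) : hat q N = q N := by
  cases N with
  | zero => rfl
  | succ N => simp [hat, h]

theorem hat_fast (q : ℕ → ℚ) (N : ℕ) : FastUpTo (hat q) N := by
  induction N with
  | zero => intro j hj i hi; omega
  | succ N ih =>
    intro j hj i hi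
    rcases Nat.lt_or_ge N j with h | h
    · obtain rfl : j = N + 1 := by omega
      by_cases hf : FastUpTo q (N + 1)
      · rw [hat_eq_self _ hf, hat_eq_self i fun j hj => hf j (by omega)]
        exact hf _ le_rfl i hi
      · have h1 : hat q (N + 1) = hat q N := by simp [hat, hf]
        rw [h1]
        rcases Nat.lt_or_ge i N with h2 | h2
        · exact ih N le_rfl i h2
        · obtain rfl : i = N := by omega
          simp
    · exact ih j h i hi

/-- The real number named by a type 1 object. -/
def realOf (α : ℕ → ℕ) : ℝ :=
  Filter.atTop.limUnder fun n => ((hat (fun k => ratOf (α k)) n : ℚ) : ℝ)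

theorem tendsto_realOf (α : ℕ → ℕ) :
    Filter.Tendsto (fun n => ((hat (fun k => ratOf (α k)) n : ℚ) : ℝ)) Filter.atTop
      (nhds (realOf α)) := by
  apply CauchySeq.tendsto_limUnder
  refine cauchySeq_of_le_geometric_two (C := 2) fun n => ?_
  have h := hat_fast (fun k => ratOf (α k)) (n + 1) (n + 1) le_rfl n (Nat.lt_succ_self n)
  rw [Real.dist_eq]
  have h' : |((hat (fun k => ratOf (α k)) n : ℚ) : ℝ) -
      ((hat (fun k => ratOf (α k)) (n + 1) : ℚ) : ℝ)| < 1 / 2 ^ n := by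
    have h2 := (Rat.cast_lt (K := ℝ)).2 h
    push_cast at h2
    exact h2
  simpa using h'.le

/-- The partial sequence `p` is everywhere defined, and a name of the real `x`. -/
def Names (p : ℕ → Part ℕ) (x : ℝ) : Prop :=
  ∃ α : ℕ → ℕ, (∀ k, p k = Part.some (α k)) ∧ realOf α = x

/-- The total functional `φ` represents the function `f : [0,1] → ℝ`: it sends every name of
`x ∈ [0,1]` to a name of `f x`. -/
def Represents (φ : (ℕ → ℕ) → ℕ → ℕ) (f : unitInterval → ℝ) : Prop :=
  ∀ (α : ℕ → ℕ) (x : unitInterval), realOf α = x → realOf (φ α) = f x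

/-- The possibly partial functional `p` represents `f : [0,1] → ℝ`: at every name of `x ∈ [0,1]` it
is defined and yields a name of `f x`. -/
def PRepresents (p : (ℕ → ℕ) → ℕ → Part ℕ) (f : unitInterval → ℝ) : Prop :=
  ∀ (α : ℕ → ℕ) (x : unitInterval), realOf α = x → Names (p α) (f x)

open Classical in
/-- The characteristic function of a set of reals, on names. -/
def charFun (S : Set ℝ) : (ℕ → ℕ) → ℕ :=
  fun α => if realOf α ∈ S then 1 else 0

/-! ### Baire 1 functions, oscillation, representations of open sets -/

/-- `f : [0,1] → ℝ` is Baire 1: a pointwise limit of a sequence of continuous functions. -/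
def IsBaireOne (f : unitInterval → ℝ) : Prop :=
  ∃ F : ℕ → unitInterval → ℝ, (∀ n, Continuous (F n)) ∧
    ∀ x, Filter.Tendsto (fun n => F n x) Filter.atTop (nhds (f x))

/-- The real-valued function `g` on `[0,1]` is the oscillation function of `f`: `g x` is the limit
as `k → ∞` of the supremum minus the infimum of `f` on the ball `B(x, 2⁻ᵏ)` in `[0,1]`. -/
def IsOscillationOf (g f : unitInterval → ℝ) : Prop :=
  ∀ x, Filter.Tendsto (fun k : ℕ =>
      (⨆ y ∈ Metric.ball x (1 / 2 ^ k), (f y : EReal)) -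
        ⨅ y ∈ Metric.ball x (1 / 2 ^ k), (f y : EReal))
    Filter.atTop (nhds (g x : EReal))

/-- R2-representation of an open set `O ⊆ [0,1]` by `Y : [0,1] → [0,1]`. -/
def IsR2 (O : Set unitInterval) (Y : unitInterval → unitInterval) : Prop :=
  O = {x | 0 < (Y x : ℝ)} ∧
    ∀ x, 0 < (Y x : ℝ) → {z : unitInterval | (z : ℝ) ∈ Set.Ioo (x - Y x : ℝ) (x + Y x)} ⊆ O

/-- R3-representation of an open set `O ⊆ [0,1]` by a continuous `Y : [0,1] → [0,1]`. -/
def IsR3 (O : Set unitInterval) (Y : unitInterval → unitInterval) : Prop :=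
  IsOpen O ∧ Continuous Y ∧ (Oᶜ.Nonempty → ∀ x, (Y x : ℝ) = Metric.infDist x Oᶜ) ∧
    (O = Set.univ → ∀ x, Y x = 1)

/-! ### The specifications -/

/-- The type `1` of elements of Baire space. -/
abbrev FinType.one : FinType := .arrow .zero .zero

/-- The type `1 → 1` of representations of real functions. -/
abbrev FinType.realFun : FinType := .arrow .one .one

/-- The type `1 → 0` of sets of reals. -/
abbrev FinType.set : FinType := .arrow .one .zero

/-- Baire realisers: on input a sequence of dense open sets of reals, output (a name of) a real in
the intersection. -/
def IsBaireRealiser (ξ : PObj (.arrow (.arrow .zero .set) .one)) : Prop :=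
  ∀ O : ℕ → Set ℝ, (∀ n, IsOpen (O n)) → (∀ n, Dense (O n)) →
    ∃ x ∈ ⋂ n, O n, Names (ξ fun n => charFun (O n)) x

/-- On input a Baire 1 function `f : [0,1] → ℝ`, its oscillation function `g`, and `n`, output an
R2-representation of the complement in `[0,1]` of `{x | g x ≥ 2⁻ⁿ}`. -/
def IsOscComplementR2 (Γ : PObj (.arrow .realFun (.arrow .realFun (.arrow .zero .realFun)))) :
    Prop :=
  ∀ f g : unitInterval → ℝ, IsBaireOne f → IsOscillationOf g f →
    ∀ φ ψ : (ℕ → ℕ) → ℕ → ℕ, Represents φ f → Represents ψ g →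
      ∀ n : ℕ, ∃ Y : unitInterval → unitInterval,
        IsR2 {x | (1 : ℝ) / 2 ^ n ≤ g x}ᶜ Y ∧ PRepresents (Γ φ ψ n) fun x => Y x

/-- On input an R2-representation of an open subset of `[0,1]`, output an R3-representation. -/
def IsR2ToR3 (Δ : PObj (.arrow .realFun .realFun)) : Prop :=
  ∀ (O : Set unitInterval) (Y : unitInterval → unitInterval), IsR2 O Y →
    ∀ φ : (ℕ → ℕ) → ℕ → ℕ, Represents φ (fun x => Y x) →
      ∃ Z : unitInterval → unitInterval, IsR3 O Z ∧ PRepresents (Δ φ) fun x => Z x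

/-- Finiteness realisers: on input a finite set `X` of reals, output (a code `γ` of) a finite
sequence of reals that includes all elements of `X`. The code has the length of the sequence as
`γ 0`, and the remaining values of `γ` interleave the names of its entries. -/
def IsFinitenessRealiser (Ω : PObj (.arrow .set .one)) : Prop :=
  ∀ X : Set ℝ, X.Finite →
    ∃ γ : ℕ → ℕ, (∀ k : ℕ, (Ω (charFun X) : ℕ → Part ℕ) k = Part.some (γ k)) ∧
      ∀ x ∈ X, ∃ i < γ 0, realOf (fun k => γ (Nat.pair i k + 1)) = x

end HigherOrder

end

namespace HigherOrder

/-! ### Uniform S1-S9 computability over a family of argument lists -/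

-- Baire realiser. For dense open sets `O n`, let h(x) be 2⁻ⁿ for the least n with x ∉ `O n`, and 0
-- if there is no such n (`exitFun`). Then h is upper semicontinuous, hence Baire 1, and it vanishes
-- on a dense set, so on [0,1] it is its own oscillation function. Thus Γ may be fed h twice, and h
-- is computable from ∃² and the given sets. Here D_n consists of the points of [0,1] that miss one
-- of `O 0`, …, `O n`, so Γ yields an R2-representation Y_n of their finite intersection
-- (`IsOscComplementR2.exists_isR2`). The values of Y_n at rational points are radii of intervals
-- inside the intersection. With them the usual proof of the Baire category theorem becomes a
-- computation: choose nested rational intervals, the radius of interval n + 1 being at most the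
-- value of Y_n at its centre, and output the limit of the centres (`exists_cptS_mem_of_dense`).
--
-- Finiteness realiser. For finite X and rational s, the translate X - s has a dense open
-- complement. Γ and then Δ yield the distance function to the part of X - s in [0,1]; its value at
-- 0, plus s, is the leftmost point of X in [s, s + 1], if there is one. Every x ∈ X arises in this
-- way from some s slightly below x (`exists_rat_infDist_eq`), so the sequence over all s covers X.
-- As ∃² decides equality of reals, a finite initial segment that still covers X can be found by
-- search (`exists_cptS_enumeration`).
--
-- Computability. `Cpt` asks for one index that works for a whole family of argument lists; taking
-- all admissible inputs as the family gives uniformity. It is closed under primitive recursion,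
-- search, application of total arguments to the oracles, and, through ∃², number quantifiers. Since
-- S8 accepts only total arguments, every functional passed to an oracle is first made total.

/-- The arguments described by the context `A`, at the instance `i`. -/
def args {ι : Type} (A : List (ι → Arg)) (i : ι) : List Arg := A.map fun a => a i

/-- The numbers `f i` are computed from the arguments `A` by one index, uniformly in `i`. -/
def Cpt {ι : Type} (A : List (ι → Arg)) (f : ι → ℕ) : Prop :=
  ∃ e, ∀ i, Computes e (args A i) (f i)

/-- The context `A` with one additional argument of type `σ` in front. -/
def push {ι : Type} (σ : FinType) (A : List (ι → Arg)) : List (ι × Obj σ → Arg) :=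
  (fun p => Arg.ofObj σ p.2) :: A.map fun a p => a p.1

/-- The context `A` with one additional number in front. -/
def pushN {ι : Type} (A : List (ι → Arg)) : List (ι × ℕ → Arg) :=
  (fun p => Arg.num p.2) :: A.map fun a p => a p.1

/-- The context `A` with one additional sequence in front. -/
def pushS {ι : Type} (A : List (ι → Arg)) : List (ι × (ℕ → ℕ) → Arg) :=
  (fun p => Arg.ofObj .one p.2) :: A.map fun a p => a p.1

theorem args_pushN {ι : Type} (A : List (ι → Arg)) (i : ι) (n : ℕ) :
    args (pushN A) (i, n) = .num n :: args A i := by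
  simp [args, pushN, Function.comp_def]

theorem args_push {ι : Type} (σ : FinType) (A : List (ι → Arg)) (i : ι) (y : Obj σ) :
    args (push σ A) (i, y) = Arg.ofObj σ y :: args A i := by
  simp [args, push, Function.comp_def]

variable {ι κ : Type} {A B : List (ι → Arg)}

/-- S6 may permute, repeat and drop arguments, so only the set of entries of a context matters. -/
theorem Cpt.mono {f : ι → ℕ} (h : Cpt A f) (hAB : A ⊆ B) : Cpt B f := by
  classical
  obtain ⟨e, he⟩ := h
  refine ⟨.S6 (A.map fun a => B.idxOf a) e, fun i => .S6 _ _ _ (args A i) _ ?_ (he i)⟩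
  simp only [args, List.map_map, List.map_inj_left, Function.comp_apply]
  intro a ha
  have h1 : B.idxOf a < B.length := List.idxOf_lt_length_iff.2 (hAB ha)
  rw [List.getElem?_eq_getElem (by simpa using h1)]
  simp

theorem Cpt.reindex {f : ι → ℕ} (h : Cpt A f) (g : κ → ι) :
    Cpt (A.map fun a k => a (g k)) fun k => f (g k) := by
  obtain ⟨e, he⟩ := h
  refine ⟨e, fun k => ?_⟩
  have := he (g k)
  simpa [args, Function.comp_def] using this

theorem Cpt.weaken (σ : FinType) {f : ι → ℕ} (h : Cpt A f) :
    Cpt (push σ A) fun p => f p.1 :=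
  (h.reindex Prod.fst).mono (List.subset_cons_self _ _)

theorem Cpt.weakenN {f : ι → ℕ} (h : Cpt A f) : Cpt (pushN A) fun p => f p.1 :=
  h.weaken .zero

theorem Cpt.weakenS {f : ι → ℕ} (h : Cpt A f) : Cpt (pushS A) fun p => f p.1 :=
  h.weaken .one

theorem Cpt.const (q : ℕ) : Cpt A fun _ => q :=
  ⟨.S2 q, fun _ => .S2 _ _⟩

theorem Cpt.head : Cpt (pushN A) fun p => p.2 :=
  ⟨.S3, fun _ => .S3 _ _⟩

theorem Cpt.bind {f : ι → ℕ} {h : ι → ℕ → ℕ} (hh : Cpt (pushN A) fun p => h p.1 p.2)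
    (hf : Cpt A f) : Cpt A fun i => h i (f i) := by
  obtain ⟨e, he⟩ := hh
  obtain ⟨e', he'⟩ := hf
  refine ⟨.S4 e e', fun i => .S4 _ _ _ _ _ (he' i) ?_⟩
  rw [← args_pushN]
  exact he (i, f i)

theorem Cpt.succ {f : ι → ℕ} (hf : Cpt A f) : Cpt A fun i => f i + 1 :=
  Cpt.bind (h := fun _ n => n + 1) ⟨.S1, fun _ => .S1 _ _⟩ hf

/-- S5 puts the counter in front of the previous value, so in the step `p.2` is the counter and
`p.1.2` the previous value. -/
theorem Cpt.natRec {n b : ι → ℕ} {s : ι → ℕ → ℕ → ℕ} (hb : Cpt A b)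
    (hs : Cpt (pushN (pushN A)) fun p => s p.1.1 p.2 p.1.2) (hn : Cpt A n) :
    Cpt A fun i => Nat.rec (motive := fun _ => ℕ) (b i) (s i) (n i) := by
  obtain ⟨e₁, h₁⟩ := hb
  obtain ⟨e₂, h₂⟩ := hs
  refine Cpt.bind (h := fun i n => Nat.rec (motive := fun _ => ℕ) (b i) (s i) n)
    ⟨.S5 e₁ e₂, ?_⟩ hn
  rintro ⟨i, n⟩
  rw [args_pushN]
  induction n with
  | zero => exact .S5_zero _ _ _ _ (h₁ i)
  | succ n ih =>
    refine .S5_succ _ _ _ _ _ _ ih ?_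
    rw [← args_pushN, ← args_pushN]
    exact h₂ ((i, _), n)

/-- Makes Mathlib's stock of primitive recursive functions available, by induction on their
derivation. -/
theorem Cpt.vector {n : ℕ} {f : List.Vector ℕ n → ℕ} (hf : Nat.Primrec' f) :
    ∀ {ι : Type} {A : List (ι → Arg)} {v : ι → List.Vector ℕ n},
      (∀ j, Cpt A fun i => (v i).get j) → Cpt A fun i => f (v i) := by
  induction hf with
  | zero => exact fun _ => .const 0
  | succ =>
    intro ι A v hv
    simpa using (hv 0).succ
  | get j => exact fun hv => hv j
  | comp g _ _ ihf ihg =>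
    intro ι A v hv
    exact ihf fun j => by simpa using ihg j hv
  | @prec n f g _ _ ihf ihg =>
    intro ι A v hv
    refine Cpt.natRec (s := fun i y IH => g (y ::ᵥ IH ::ᵥ (v i).tail))
      (ihf fun j => ?_) (ihg fun j => ?_) ?_
    · simpa using hv j.succ
    · refine Fin.cases ?_ (fun j => Fin.cases ?_ (fun j => ?_) j) j
      · simpa using Cpt.head
      · exact Cpt.head.weakenN
      · simpa using (hv j.succ).weakenN.weakenN
    · simpa using hv 0

theorem Cpt.primrec {g : ℕ → ℕ} (hg : Primrec g) {f : ι → ℕ} (hf : Cpt A f) :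
    Cpt A fun i => g (f i) :=
  Cpt.vector (Nat.Primrec'.prim_iff₁.2 hg) (v := fun i => f i ::ᵥ .nil) fun j => by
    fin_cases j; exact hf

theorem Cpt.primrec₂ {g : ℕ → ℕ → ℕ} (hg : Primrec₂ g) {f₁ f₂ : ι → ℕ} (h₁ : Cpt A f₁)
    (h₂ : Cpt A f₂) : Cpt A fun i => g (f₁ i) (f₂ i) :=
  Cpt.vector (Nat.Primrec'.prim_iff₂.2 hg) (v := fun i => f₁ i ::ᵥ f₂ i ::ᵥ .nil) fun j => by
    fin_cases j
    · exact h₁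
    · exact h₂

theorem Cpt.add {f g : ι → ℕ} (hf : Cpt A f) (hg : Cpt A g) : Cpt A fun i => f i + g i :=
  .primrec₂ Primrec.nat_add hf hg

theorem Cpt.mul {f g : ι → ℕ} (hf : Cpt A f) (hg : Cpt A g) : Cpt A fun i => f i * g i :=
  .primrec₂ Primrec.nat_mul hf hg

theorem Cpt.sub {f g : ι → ℕ} (hf : Cpt A f) (hg : Cpt A g) : Cpt A fun i => f i - g i :=
  .primrec₂ Primrec.nat_sub hf hg

theorem Cpt.pair {f g : ι → ℕ} (hf : Cpt A f) (hg : Cpt A g) :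
    Cpt A fun i => Nat.pair (f i) (g i) :=
  .primrec₂ Primrec₂.natPair hf hg

theorem Cpt.fst {f : ι → ℕ} (hf : Cpt A f) : Cpt A fun i => (f i).unpair.1 :=
  .primrec (Primrec.fst.comp Primrec.unpair) hf

theorem Cpt.snd {f : ι → ℕ} (hf : Cpt A f) : Cpt A fun i => (f i).unpair.2 :=
  .primrec (Primrec.snd.comp Primrec.unpair) hf

theorem Cpt.two_pow {f : ι → ℕ} (hf : Cpt A f) : Cpt A fun i => 2 ^ f i := by
  have h : (fun i => 2 ^ f i) =
      fun i => Nat.rec (motive := fun _ => ℕ) 1 (fun _ m => m * 2) (f i) := by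
    funext i
    induction f i with
    | zero => rfl
    | succ n ih => rw [pow_succ, ih]
  rw [h]
  exact .natRec (s := fun _ _ m => m * 2) (.const 1) (Cpt.head.weakenN.mul (.const 2)) hf

/-! ### Decidable predicates -/

open Classical in
/-- The predicate `p` is decided from the arguments `A`; the value `0` stands for truth. -/
def CptP (A : List (ι → Arg)) (p : ι → Prop) : Prop :=
  Cpt A fun i => if p i then 0 else 1

theorem CptP.of_iff {p q : ι → Prop} (h : CptP A p) (hpq : ∀ i, q i ↔ p i) : CptP A q := by
  obtain rfl : q = p := funext fun i => propext (hpq i)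
  exact h

open Classical in
-- Recursion on the truth value: 0 returns the base `f`, and 1 takes a single step to `g`.
theorem Cpt.ite {p : ι → Prop} {f g : ι → ℕ} (hp : CptP A p) (hf : Cpt A f) (hg : Cpt A g) :
    Cpt A fun i => if p i then f i else g i := by
  have h := Cpt.natRec (s := fun i _ _ => g i) hf hg.weakenN.weakenN hp
  convert h using 2 with i
  by_cases hi : p i <;> simp [hi]

theorem CptP.weakenN {p : ι → Prop} (h : CptP A p) : CptP (pushN A) fun q => p q.1 :=
  Cpt.weakenN h

theorem CptP.eq_zero {f : ι → ℕ} (hf : Cpt A f) : CptP A fun i => f i = 0 := by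
  have h := Cpt.primrec₂ Primrec.nat_sub (.const 1) ((Cpt.const 1).sub hf)
  unfold CptP
  convert h using 2 with i
  split <;> simp_all [Nat.sub_eq_zero_of_le, Nat.one_le_iff_ne_zero]

theorem CptP.le {f g : ι → ℕ} (hf : Cpt A f) (hg : Cpt A g) : CptP A fun i => f i ≤ g i :=
  (CptP.eq_zero (hf.sub hg)).of_iff fun _ => by omega

theorem CptP.not {p : ι → Prop} (h : CptP A p) : CptP A fun i => ¬ p i := by
  classical
  unfold CptP
  convert Cpt.ite h (.const 1) (.const 0) using 2 with i
  by_cases hi : p i <;> simp [hi]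

theorem CptP.and {p q : ι → Prop} (hp : CptP A p) (hq : CptP A q) : CptP A fun i => p i ∧ q i := by
  classical
  unfold CptP
  convert Cpt.ite hp hq (.const 1) using 2 with i
  by_cases hi : p i <;> simp [hi]

theorem CptP.imp {p q : ι → Prop} (hp : CptP A p) (hq : CptP A q) : CptP A fun i => p i → q i :=
  (hp.and hq.not).not.of_iff fun _ => by tauto

theorem CptP.or {p q : ι → Prop} (hp : CptP A p) (hq : CptP A q) : CptP A fun i => p i ∨ q i :=
  (hp.not.and hq.not).not.of_iff fun _ => by tauto

theorem CptP.iff {p q : ι → Prop} (hp : CptP A p) (hq : CptP A q) : CptP A fun i => p i ↔ q i :=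
  ((hp.imp hq).and (hq.imp hp)).of_iff fun _ => by tauto

theorem CptP.lt {f g : ι → ℕ} (hf : Cpt A f) (hg : Cpt A g) : CptP A fun i => f i < g i :=
  (CptP.le hf.succ hg).of_iff fun _ => Iff.rfl

theorem CptP.eq {f g : ι → ℕ} (hf : Cpt A f) (hg : Cpt A g) : CptP A fun i => f i = g i :=
  ((CptP.le hf hg).and (CptP.le hg hf)).of_iff fun _ => by omega

/-! ### Unbounded search -/

/-- Search by S9: the index under consideration is itself the first argument. -/
theorem Cpt.least {p : ι → ℕ → Prop} (hp : CptP (pushN A) fun q => p q.1 q.2)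
    (hex : ∀ i, ∃ n, p i n) : Cpt A fun i => sInf {n | p i n} := by
  classical
  obtain ⟨t, ht⟩ := hp
  set L := A.length with hL
  have hlen : ∀ i, (args A i).length = L := fun i => by simp [args, hL]
  -- On arguments (code of `e`, n, Φ), `test` drops the code and decides p at n. S5 branches on the
  -- answer: 0 returns n, while 1 calls S9 with the code of `e` on (code of `e`, n + 1, Φ). In
  -- `next` the arguments are preceded by n + 1, the counter and the previous value, so position 3
  -- is the code and Φ starts at position 5.
  let test : Index := .S6 (1 :: (List.range L).map (· + 2)) t
  let halt : Index := .S6 [1] .S3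
  let next : Index := .S4 (.S6 (3 :: 3 :: 0 :: (List.range L).map (· + 5)) (.S9 (L + 2)))
    (.S6 [3] .S1)
  let e : Index := .S4 (.S5 halt next) test
  have hrange : ∀ (i : ι) (Ψ : List Arg),
      (List.range L).map (fun j => (Ψ ++ args A i)[j + Ψ.length]?) = (args A i).map some := by
    intro i Ψ
    apply List.ext_getElem?
    intro j
    by_cases hj : j < L
    · rw [List.getElem?_map, List.getElem?_map, List.getElem?_range hj,
        List.getElem?_eq_getElem (l := args A i) (by rw [hlen]; exact hj)]
      simp [List.getElem?_append,
        List.getElem?_eq_getElem (l := args A i) (i := j) (by rw [hlen]; exact hj)]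
    · rw [List.getElem?_eq_none (by simpa using hj),
        List.getElem?_eq_none (by simpa [hlen] using hj)]
  -- Induction on the distance k from n to the least solution.
  have key : ∀ i k n, n + k = sInf {n | p i n} →
      Computes e (.num e.code :: .num n :: args A i) (sInf {n | p i n}) := by
    intro i k
    induction k with
    | zero =>
      intro n hn
      have hpn : p i n := by
        have := Nat.sInf_mem (s := {n | p i n}) (hex i)
        rw [← hn] at this; exact this
      have h1 := ht (i, n)
      rw [args_pushN] at h1
      simp only [hpn, if_true] at h1
      refine .S4 _ _ _ 0 _ (.S6 _ _ _ _ _ ?_ h1) (.S5_zero _ _ _ _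
        (.S6 _ _ _ [.num n] _ ?_ ?_))
      · simpa [Function.comp_def] using hrange i [.num e.code, .num n]
      · simp
      · rw [← hn]; exact .S3 _ _
    | succ k ih =>
      intro n hn
      have hpn : ¬ p i n := fun h => by
        have := Nat.sInf_le (s := {n | p i n}) h
        omega
      have h1 := ht (i, n)
      rw [args_pushN] at h1
      simp only [hpn, if_false] at h1
      refine .S4 _ _ _ 1 _ (.S6 _ _ _ _ _ ?_ h1) (.S5_succ _ _ _ 0 n _
        (.S5_zero _ _ _ _ (.S6 _ _ _ [.num n] _ ?_ (.S3 _ _)))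
        (.S4 _ _ _ (n + 1) _ (.S6 _ _ _ [.num n] _ ?_ (.S1 _ _))
          (.S6 _ _ _ (.num e.code :: .num e.code :: .num (n + 1) :: args A i) _ ?_
            (.S9 _ _ _ _ ?_ ?_))))
      · simpa [Function.comp_def] using hrange i [.num e.code, .num n]
      · simp
      · simp
      · simpa [Function.comp_def] using
          hrange i [.num (n + 1), .num 0, .num n, .num e.code, .num n]
      · simp [hlen]
      · rw [List.take_of_length_le (by simp [hlen])]
        exact ih (n + 1) (by omega)
  exact ⟨.S4 (.S4 e (.S2 e.code)) (.S2 0), fun i => .S4 _ _ _ _ _ (.S2 _ _)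
    (.S4 _ _ _ _ _ (.S2 _ _) (key i _ 0 (zero_add _)))⟩

/-! ### Abstraction and functional application -/

/-- The functionals `a i` are computed from the arguments `A`, uniformly in `i`. -/
def Abs : (σ : FinType) → {ι : Type} → List (ι → Arg) → (ι → Obj σ) → Prop
  | .zero, _, A, f => Cpt A f
  | .arrow σ τ, _, A, G => Abs τ (push σ A) fun p => G p.1 p.2

/-- Applied to suitable computable arguments, the functionals `F i` have the values `f i`. -/
def App : (σ : FinType) → {ι : Type} → List (ι → Arg) → (ι → PObj σ) → (ι → ℕ) → Prop
  | .zero, ι, _, F, f => ∀ i : ι, Membership.mem (γ := Part ℕ) (F i) (f i)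
  | .arrow σ τ, ι, A, F, f =>
      ∃ a : ι → Obj σ, Abs σ A a ∧ App τ A (fun i => F i (a i)) f

theorem push_subset (σ : FinType) (h : A ⊆ B) : push σ A ⊆ push σ B :=
  List.cons_subset_cons _ (List.map_subset _ h)

theorem Abs.mono : ∀ {σ : FinType} {ι : Type} {A B : List (ι → Arg)} {a : ι → Obj σ},
    Abs σ A a → A ⊆ B → Abs σ B a
  | .zero, _, _, _, _, h, hAB => Cpt.mono h hAB
  | .arrow σ τ, _, _, _, _, h, hAB => Abs.mono (σ := τ) h (push_subset σ hAB)

theorem Abs.reindex : ∀ {σ : FinType} {ι κ : Type} {A : List (ι → Arg)} {a : ι → Obj σ},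
    Abs σ A a → ∀ g : κ → ι, Abs σ (A.map fun a k => a (g k)) fun k => a (g k)
  | .zero, _, _, _, _, h, g => Cpt.reindex h g
  | .arrow σ τ, ι, κ, A, _, h, g => by
    have h1 := Abs.reindex (σ := τ) h fun p : κ × Obj σ => (g p.1, p.2)
    refine Abs.mono (σ := τ) h1 ?_
    simp [push, Function.comp_def]

theorem Abs.weakenN {σ : FinType} {a : ι → Obj σ} (h : Abs σ A a) :
    Abs σ (pushN A) fun p => a p.1 :=
  (h.reindex Prod.fst).mono (List.subset_cons_self _ _)

theorem App.mono : ∀ {σ : FinType} {ι : Type} {A B : List (ι → Arg)} {F : ι → PObj σ}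
    {f : ι → ℕ}, App σ A F f → A ⊆ B → App σ B F f
  | .zero, _, _, _, _, _, h, _ => h
  | .arrow _ _, _, _, _, _, _, ⟨a, ha, h⟩, hAB => ⟨a, ha.mono hAB, App.mono h hAB⟩

theorem Abs.exists_index : ∀ {σ : FinType} {ι : Type} {A : List (ι → Arg)} {a : ι → Obj σ},
    Abs σ A a → ∃ d, ∀ i, Abstracts d σ (args A i) (a i)
  | .zero, _, _, _, ⟨e, he⟩ => ⟨e, fun i => .zero _ _ _ (he i)⟩
  | .arrow σ τ, _, A, a, h => by
    obtain ⟨d, hd⟩ := Abs.exists_index (σ := τ) h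
    refine ⟨d, fun i => .arrow _ _ _ _ _ fun y => ?_⟩
    rw [← args_push]
    exact hd (i, y)

theorem App.exists_indices : ∀ {σ : FinType} {ι : Type} {A : List (ι → Arg)} {F : ι → PObj σ}
    {f : ι → ℕ}, App σ A F f → ∃ ds, ∀ i, Applies ds σ (F i) (args A i) (f i)
  | .zero, _, _, _, _, h => ⟨[], fun i => .nil _ _ _ (h i)⟩
  | .arrow σ τ, _, A, F, f, ⟨a, ha, h⟩ => by
    obtain ⟨d, hd⟩ := ha.exists_index
    obtain ⟨ds, hds⟩ := App.exists_indices (σ := τ) h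
    exact ⟨d :: ds, fun i => .cons _ _ _ _ _ _ _ _ (hd i) (hds i)⟩

/-- Application of one of the functionals in the context. -/
theorem Cpt.oracle {σ τ : FinType} {F : ι → PObj (.arrow σ τ)} {f : ι → ℕ}
    (hF : (fun i => Arg.fn σ τ (F i)) ∈ A) (h : App (.arrow σ τ) A F f) : Cpt A f := by
  -- S8 applies only the first argument, so a copy of the functional is put in front; `Cpt.mono`
  -- merges it with the original afterwards.
  have hsub : A ⊆ (fun i => Arg.fn σ τ (F i)) :: A := List.subset_cons_self _ _
  obtain ⟨ds, hds⟩ := (h.mono hsub).exists_indices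
  have h1 : Cpt ((fun i => Arg.fn σ τ (F i)) :: A) f := by
    refine ⟨.S8 ds.length ds.get, fun i => .S8 _ _ _ _ _ _ _ ?_⟩
    rw [List.ofFn_get]
    exact hds i
  exact h1.mono (List.cons_subset.2 ⟨hF, fun _ => id⟩)

/-- Names, or sequences of numbers, that are computed from `A`. -/
abbrev CptS (A : List (ι → Arg)) (a : ι → ℕ → ℕ) : Prop :=
  Cpt (pushN A) fun p => a p.1 p.2

theorem CptS.abs {a : ι → ℕ → ℕ} (h : CptS A a) : Abs .one A a := h

theorem Abs.lamSS {a : ι → (ℕ → ℕ) → ℕ → ℕ} (h : CptS (pushS A) fun p => a p.1 p.2) :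
    Abs .realFun A a := h

theorem CptS.app {a : ι → ℕ → ℕ} {f : ι → ℕ} (h : CptS A a) (hf : Cpt A f) :
    Cpt A fun i => a i (f i) :=
  Cpt.bind h hf

theorem CptS.weakenN {a : ι → ℕ → ℕ} (h : CptS A a) : CptS (pushN A) fun p => a p.1 :=
  Abs.weakenN (σ := .one) h

theorem CptS.const {f : ι → ℕ} (h : Cpt A f) : CptS A fun i _ => f i := h.weakenN

theorem CptS.var {a : ι → ℕ → ℕ} (h : (fun i => Arg.ofObj .one (a i)) ∈ A) : CptS A a := by
  have h1 : (fun p : ι × ℕ => Arg.ofObj .one (a p.1)) ∈ pushN A :=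
    List.mem_cons_of_mem _ (List.mem_map_of_mem (f := fun a (p : ι × ℕ) => a p.1) h)
  exact Cpt.oracle h1 ⟨fun p => p.2, Cpt.head, fun p => Part.mem_some _⟩

theorem CptS.head : CptS (pushS A) fun p => p.2 :=
  .var List.mem_cons_self

/-! ### Arithmetical quantifiers -/

/-- Kleene's quantifier is among the arguments. -/
class HasE {ι : Type} (A : List (ι → Arg)) : Prop where
  mem : (fun _ => Arg.ofObj (.arrow .one .zero) existsTwo) ∈ A

theorem mem_pushN {a : ι → Arg} (h : a ∈ A) : (fun p => a p.1) ∈ pushN A :=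
  List.mem_cons_of_mem _ (List.mem_map_of_mem (f := fun a (p : ι × ℕ) => a p.1) h)

theorem mem_pushS {a : ι → Arg} (h : a ∈ A) : (fun p => a p.1) ∈ pushS A :=
  List.mem_cons_of_mem _ (List.mem_map_of_mem (f := fun a (p : ι × (ℕ → ℕ)) => a p.1) h)

instance [h : HasE A] : HasE (pushN A) := ⟨mem_pushN h.mem⟩

instance [h : HasE A] : HasE (pushS A) := ⟨mem_pushS h.mem⟩

/-- ∃² looks for the value 0, which stands for truth, so the decision function itself is its
argument. -/
theorem CptP.exists [hE : HasE A] {p : ι → ℕ → Prop} (hp : CptP (pushN A) fun q => p q.1 q.2) :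
    CptP A fun i => ∃ n, p i n := by
  classical
  refine Cpt.oracle hE.mem ⟨fun i n => if p i n then (0 : ℕ) else (1 : ℕ), CptS.abs hp,
    fun i => ?_⟩
  have h : existsTwo (fun n => if p i n then 0 else 1) = if ∃ n, p i n then 0 else 1 := by
    simp [existsTwo]
  exact Part.mem_some_iff.2 h.symm

theorem CptP.forall [HasE A] {p : ι → ℕ → Prop} (hp : CptP (pushN A) fun q => p q.1 q.2) :
    CptP A fun i => ∀ n, p i n :=
  (CptP.exists (p := fun i n => ¬ p i n) hp.not).not.of_iff fun _ => by simp

theorem CptP.forall₂ [HasE A] {p : ι → ℕ → ℕ → Prop}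
    (hp : CptP (pushN (pushN A)) fun q => p q.1.1 q.1.2 q.2) : CptP A fun i => ∀ m n, p i m n :=
  CptP.forall (p := fun i m => ∀ n, p i m n)
    (CptP.forall (p := fun (q : ι × ℕ) n => p q.1 q.2 n) hp)

/-- ∃² detects an empty set beforehand; the search then stops at 0, which is also the infimum of ∅
in ℕ. -/
theorem Cpt.sInf [HasE A] {p : ι → ℕ → Prop} (hp : CptP (pushN A) fun q => p q.1 q.2) :
    Cpt A fun i => InfSet.sInf {n | p i n} := by
  have h1 := Cpt.least (p := fun i n => p i n ∨ ¬ ∃ m, p i m) (hp.or (CptP.exists hp).not.weakenN)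
    fun i => by
      by_cases h : ∃ m, p i m
      · obtain ⟨m, hm⟩ := h
        exact ⟨m, .inl hm⟩
      · exact ⟨0, .inr h⟩
  convert h1 using 2 with i
  by_cases h : ∃ m, p i m
  · simp [h]
  · simp [not_exists.1 h]

/-! ### Rational numbers -/

/-- Codes of the rationals `r i` are computed from the arguments `A`. -/
def CptQ (A : List (ι → Arg)) (r : ι → ℚ) : Prop :=
  ∃ c : ι → ℕ, Cpt A c ∧ ∀ i, ratOf (c i) = r i

theorem ratOf_pair (a b c : ℕ) :
    ratOf (Nat.pair (Nat.pair a b) c) = ((a : ℚ) - b) / (c + 1) := by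
  simp [ratOf]

theorem ratOf_surjective : Function.Surjective ratOf := by
  intro r
  refine ⟨Nat.pair (Nat.pair r.num.toNat (-r.num).toNat) (r.den - 1), ?_⟩
  have h1 : ((r.num.toNat : ℕ) : ℚ) - ((-r.num).toNat : ℕ) = r.num := by
    have : ((r.num.toNat : ℕ) : ℤ) - ((-r.num).toNat : ℕ) = r.num := by omega
    exact_mod_cast this
  have h2 : ((r.den - 1 : ℕ) : ℚ) + 1 = r.den := by
    have := r.den_pos
    exact_mod_cast (by omega : r.den - 1 + 1 = r.den)
  rw [ratOf_pair, h1, h2, Rat.num_div_den]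

theorem ratOf_zero : ratOf 0 = 0 := by
  simp [ratOf]

theorem CptQ.ratOf {c : ι → ℕ} (hc : Cpt A c) : CptQ A fun i => ratOf (c i) :=
  ⟨c, hc, fun _ => rfl⟩

theorem CptQ.weakenN {r : ι → ℚ} (h : CptQ A r) : CptQ (pushN A) fun p => r p.1 :=
  let ⟨_, hc, h⟩ := h
  ⟨_, hc.weakenN, fun p => h p.1⟩

theorem CptQ.const (r : ℚ) : CptQ A fun _ => r :=
  let ⟨c, hc⟩ := ratOf_surjective r
  ⟨_, .const c, fun _ => hc⟩

theorem CptQ.neg {r : ι → ℚ} (h : CptQ A r) : CptQ A fun i => -r i := by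
  obtain ⟨c, hc, h⟩ := h
  obtain rfl : (fun i => HigherOrder.ratOf (c i)) = r := funext h
  refine ⟨_, (hc.fst.snd.pair hc.fst.fst).pair hc.snd, fun i => ?_⟩
  rw [ratOf_pair]
  simp only [HigherOrder.ratOf]
  ring

theorem CptQ.add {r s : ι → ℚ} (hr : CptQ A r) (hs : CptQ A s) : CptQ A fun i => r i + s i := by
  obtain ⟨c, hc, hr⟩ := hr
  obtain ⟨d, hd, hs⟩ := hs
  obtain rfl : (fun i => HigherOrder.ratOf (c i)) = r := funext hr
  obtain rfl : (fun i => HigherOrder.ratOf (d i)) = s := funext hs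
  -- A code stores its denominator minus one, and (c + 1)(d + 1) - 1 = cd + c + d.
  refine ⟨_, (((hc.fst.fst.mul hd.snd.succ).add (hd.fst.fst.mul hc.snd.succ)).pair
    ((hc.fst.snd.mul hd.snd.succ).add (hd.fst.snd.mul hc.snd.succ))).pair
    ((hc.snd.mul hd.snd).add (hc.snd.add hd.snd)), fun i => ?_⟩
  rw [ratOf_pair]
  simp only [HigherOrder.ratOf]
  rw [div_add_div _ _ (by positivity) (by positivity)]
  push_cast
  congr 1 <;> ring

theorem CptQ.sub {r s : ι → ℚ} (hr : CptQ A r) (hs : CptQ A s) : CptQ A fun i => r i - s i := by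
  simpa only [sub_eq_add_neg] using hr.add hs.neg

theorem CptQ.inv_two_pow {f : ι → ℕ} (hf : Cpt A f) : CptQ A fun i => 1 / 2 ^ f i := by
  refine ⟨_, ((Cpt.const 1).pair (.const 0)).pair (hf.two_pow.sub (.const 1)), fun i => ?_⟩
  rw [ratOf_pair, Nat.cast_sub Nat.one_le_two_pow]
  simp

theorem CptP.ratLt {r s : ι → ℚ} (hr : CptQ A r) (hs : CptQ A s) : CptP A fun i => r i < s i := by
  obtain ⟨c, hc, hr⟩ := hr
  obtain ⟨d, hd, hs⟩ := hs
  refine (CptP.lt ((hc.fst.fst.mul hd.snd.succ).add (hd.fst.snd.mul hc.snd.succ))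
    ((hd.fst.fst.mul hc.snd.succ).add (hc.fst.snd.mul hd.snd.succ))).of_iff fun i => ?_
  rw [← hr, ← hs, HigherOrder.ratOf, HigherOrder.ratOf,
    div_lt_div_iff₀ (by positivity) (by positivity),
    ← Nat.cast_lt (α := ℚ)]
  push_cast
  constructor <;> intro h <;> nlinarith

theorem CptP.ratLe {r s : ι → ℚ} (hr : CptQ A r) (hs : CptQ A s) : CptP A fun i => r i ≤ s i :=
  (CptP.ratLt hs hr).not.of_iff fun _ => not_lt.symm

theorem CptP.absLt {r s : ι → ℚ} (hr : CptQ A r) (hs : CptQ A s) : CptP A fun i => |r i| < s i :=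
  ((CptP.ratLt hs.neg hr).and (CptP.ratLt hr hs)).of_iff fun _ => abs_lt

/-! ### Real numbers -/

theorem FastUpTo.mono {q : ℕ → ℚ} {m n : ℕ} (h : FastUpTo q n) (hmn : m ≤ n) : FastUpTo q m :=
  fun j hj => h j (hj.trans hmn)

/-- `m` is the place whose entry the hat function returns at `n`. -/
def IsHatIndex (q : ℕ → ℚ) (n m : ℕ) : Prop :=
  m ≤ n ∧ FastUpTo q m ∧ (m = n ∨ ¬ FastUpTo q (m + 1))

theorem exists_isHatIndex (q : ℕ → ℚ) (n : ℕ) : ∃ m, IsHatIndex q n m := by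
  induction n with
  | zero => exact ⟨0, le_rfl, fun j hj i hi => by omega, .inl rfl⟩
  | succ n ih =>
    by_cases h : FastUpTo q (n + 1)
    · exact ⟨n + 1, le_rfl, h, .inl rfl⟩
    · obtain ⟨m, h1, h2, h3⟩ := ih
      refine ⟨m, by omega, h2, .inr ?_⟩
      rcases h3 with rfl | h3
      exacts [h, h3]

theorem IsHatIndex.hat_eq {q : ℕ → ℚ} {n m : ℕ} (h : IsHatIndex q n m) : hat q n = q m := by
  obtain ⟨h1, h2, h3⟩ := h
  induction n, h1 using Nat.le_induction with
  | base => exact hat_eq_self _ h2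
  | succ n hn ih =>
    have h4 : ¬ FastUpTo q (m + 1) := h3.resolve_left (by omega)
    have h5 : ¬ FastUpTo q (n + 1) := fun h => h4 (h.mono (by omega))
    rw [← ih (.inr h4)]
    simp [hat, h5]

theorem abs_hat_sub_realOf_le (α : ℕ → ℕ) (n : ℕ) :
    |((hat (fun k => ratOf (α k)) n : ℚ) : ℝ) - realOf α| ≤ 1 / 2 ^ n := by
  have h1 := ((tendsto_realOf α).const_sub ((hat (fun k => ratOf (α k)) n : ℚ) : ℝ)).abs
  refine le_of_tendsto h1 ?_
  filter_upwards [Filter.eventually_gt_atTop n] with m hm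
  have h := hat_fast (fun k => ratOf (α k)) m m le_rfl n hm
  have h' := (Rat.cast_le (K := ℝ)).2 h.le
  push_cast at h'
  exact h'

theorem realOf_eq_of_tendsto {α : ℕ → ℕ} {x : ℝ}
    (hα : ∀ i j, i < j → |ratOf (α i) - ratOf (α j)| < 1 / 2 ^ i)
    (hx : Filter.Tendsto (fun n => ((ratOf (α n) : ℚ) : ℝ)) Filter.atTop (nhds x)) :
    realOf α = x := by
  refine tendsto_nhds_unique (tendsto_realOf α) ?_
  convert hx using 3 with n
  exact hat_eq_self _ fun j _ i hi => hα i j hi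

theorem realOf_const (c : ℕ) : realOf (fun _ => c) = ratOf c :=
  realOf_eq_of_tendsto (by simp) tendsto_const_nhds

theorem tendsto_one_div_two_pow :
    Filter.Tendsto (fun n : ℕ => (1 : ℝ) / 2 ^ n) Filter.atTop (nhds 0) := by
  simpa using tendsto_pow_atTop_nhds_zero_of_lt_one (r := (2 : ℝ)⁻¹) (by norm_num) (by norm_num)

/-- Term n of the frozen sequence is within 2⁻ⁿ of the limit. Locating that term by `IsHatIndex`
leaves only number quantifiers, which ∃² decides. -/
theorem realOf_le_iff (α : ℕ → ℕ) (r : ℚ) :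
    realOf α ≤ r ↔ ∀ n m, IsHatIndex (fun k => ratOf (α k)) n m → ratOf (α m) ≤ r + 1 / 2 ^ n := by
  constructor
  · intro h n m hm
    have h1 := abs_le.1 (abs_hat_sub_realOf_le α n)
    rw [hm.hat_eq] at h1
    have h2 : ((ratOf (α m) : ℚ) : ℝ) ≤ r + 1 / 2 ^ n := by linarith
    refine (Rat.cast_le (K := ℝ)).1 ?_
    push_cast
    exact h2
  · intro h
    have h0 : Filter.Tendsto (fun n : ℕ => (r : ℝ) + 1 / 2 ^ n) Filter.atTop (nhds (r + 0)) :=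
      tendsto_const_nhds.add tendsto_one_div_two_pow
    rw [add_zero] at h0
    refine le_of_tendsto_of_tendsto' (tendsto_realOf α) h0 fun n => ?_
    obtain ⟨m, hm⟩ := exists_isHatIndex (fun k => ratOf (α k)) n
    rw [hm.hat_eq]
    have h' := (Rat.cast_le (K := ℝ)).2 (h n m hm)
    push_cast at h'
    exact h'

/-- Names of the reals `x i` are computed from the arguments `A`. -/
def CptR (A : List (ι → Arg)) (x : ι → ℝ) : Prop :=
  ∃ a : ι → ℕ → ℕ, CptS A a ∧ ∀ i, realOf (a i) = x i

theorem CptS.cptR {a : ι → ℕ → ℕ} (h : CptS A a) : CptR A fun i => realOf (a i) :=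
  ⟨a, h, fun _ => rfl⟩

theorem CptR.weakenN {x : ι → ℝ} (h : CptR A x) : CptR (pushN A) fun p => x p.1 :=
  let ⟨_, ha, h⟩ := h
  ⟨_, ha.weakenN, fun p => h p.1⟩

theorem CptP.fastUpTo [HasE A] {a : ι → ℕ → ℕ} (ha : CptS A a) {N : ι → ℕ} (hN : Cpt A N) :
    CptP A fun i => FastUpTo (fun k => ratOf (a i k)) (N i) := by
  have hj : Cpt (pushN (pushN A)) fun p => p.1.2 := Cpt.head.weakenN
  have hi : Cpt (pushN (pushN A)) fun p => p.2 := Cpt.head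
  have h1 := CptP.absLt ((CptQ.ratOf (ha.weakenN.weakenN.app hi)).sub
    (CptQ.ratOf (ha.weakenN.weakenN.app hj))) (.inv_two_pow hi)
  have h2 := (CptP.le hj hN.weakenN.weakenN).imp ((CptP.lt hi hj).imp h1)
  refine (CptP.forall₂ (p := fun i m n => m ≤ N i → n < m →
    |ratOf (a i n) - ratOf (a i m)| < 1 / 2 ^ n) h2).of_iff fun i => ?_
  exact ⟨fun h j i hj hi => h j hj i hi, fun h j hj i hi => h j i hj hi⟩

theorem CptR.le [HasE A] {x : ι → ℝ} {r : ι → ℚ} (hx : CptR A x) (hr : CptQ A r) :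
    CptP A fun i => x i ≤ r i := by
  obtain ⟨a, ha, hx⟩ := hx
  have hn : Cpt (pushN (pushN A)) fun p => p.1.2 := Cpt.head.weakenN
  have hm : Cpt (pushN (pushN A)) fun p => p.2 := Cpt.head
  have ha' := ha.weakenN.weakenN
  have h1 := (CptP.le hm hn).and ((CptP.fastUpTo ha' hm).and
    ((CptP.eq hm hn).or (CptP.fastUpTo ha' hm.succ).not))
  have h2 := CptP.ratLe (CptQ.ratOf (ha'.app hm)) (hr.weakenN.weakenN.add (.inv_two_pow hn))
  refine (CptP.forall₂ (p := fun i n m =>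
    IsHatIndex (fun k => ratOf (a i k)) n m → ratOf (a i m) ≤ r i + 1 / 2 ^ n)
    (h1.imp h2)).of_iff fun i => ?_
  rw [← hx, realOf_le_iff]

/-- Term n of the name is the rational of least code in [x, x + 2⁻ⁿ). Two such terms m < n differ by
less than 2⁻ᵐ, so the hat function changes nothing. Real arithmetic thereby reduces to comparisons
with rationals. -/
theorem CptR.of_le {x : ι → ℝ} (h : CptP (pushN A) fun p => x p.1 ≤ ratOf p.2) : CptR A x := by
  classical
  let P : ι × ℕ → ℕ → Prop := fun p c =>
    x p.1 ≤ ratOf c ∧ ¬ x p.1 ≤ ((ratOf c - 1 / 2 ^ p.2 : ℚ) : ℝ)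
  have hP : ∀ p, ∃ c, P p c := by
    intro p
    have hpos : (0 : ℝ) < 1 / 2 ^ p.2 := by positivity
    obtain ⟨r, h1, h2⟩ := exists_rat_btwn (lt_add_of_pos_right (x p.1) hpos)
    obtain ⟨c, rfl⟩ := ratOf_surjective r
    refine ⟨c, h1.le, ?_⟩
    push_cast
    linarith
  have h' : CptS A fun i n => if x i ≤ ratOf n then 0 else 1 := h
  have h2 := h'.weakenN.weakenN
  obtain ⟨d, hd, hde⟩ : CptQ (pushN (pushN A)) fun q => ratOf q.2 - 1 / 2 ^ q.1.2 :=
    (CptQ.ratOf .head).sub (.inv_two_pow Cpt.head.weakenN)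
  have h3 : CptP (pushN (pushN A)) fun q => x q.1.1 ≤ ratOf q.2 := h2.app .head
  have h4 : CptP (pushN (pushN A)) fun q => x q.1.1 ≤ ratOf (d q) := h2.app hd
  have hcpt := Cpt.least (p := P) ((h3.and h4.not).of_iff fun q => by simp only [P, hde]) hP
  suffices key : ∀ i (α : ℕ → ℕ), (∀ n, P (i, n) (α n)) → realOf α = x i from
    ⟨fun i n => sInf {c | P (i, n) c}, hcpt, fun i => key i _ fun n => Nat.sInf_mem (hP (i, n))⟩
  intro i α hmem
  have hlt : ∀ n, (ratOf (α n) : ℝ) < x i + 1 / 2 ^ n := fun n => by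
    have := (hmem n).2
    push_cast at this
    linarith
  have hle : ∀ n, x i ≤ ratOf (α n) := fun n => (hmem n).1
  refine realOf_eq_of_tendsto (fun m n hmn => ?_) ?_
  · have h5 : (1 : ℝ) / 2 ^ n ≤ 1 / 2 ^ m := by gcongr; norm_num
    refine (Rat.cast_lt (K := ℝ)).1 ?_
    push_cast
    rw [abs_lt]
    constructor <;> linarith [hlt m, hlt n, hle m, hle n]
  · have h0 : Filter.Tendsto (fun n : ℕ => x i + 1 / 2 ^ n) Filter.atTop (nhds (x i + 0)) :=
      tendsto_const_nhds.add tendsto_one_div_two_pow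
    rw [add_zero] at h0
    exact tendsto_of_tendsto_of_tendsto_of_le_of_le tendsto_const_nhds h0 hle fun n => (hlt n).le

theorem CptR.add_rat [HasE A] {x : ι → ℝ} {r : ι → ℚ} (hx : CptR A x) (hr : CptQ A r) :
    CptR A fun i => x i + r i := by
  refine CptR.of_le ((CptR.le hx.weakenN ((CptQ.ratOf .head).sub hr.weakenN)).of_iff fun p => ?_)
  push_cast
  exact le_sub_iff_add_le.symm

theorem CptR.rat_le [HasE A] {x : ι → ℝ} {r : ι → ℚ} (hx : CptR A x) (hr : CptQ A r) :
    CptP A fun i => r i ≤ x i := by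
  have h1 := (hx.weakenN.le (.ratOf .head)).and (CptP.ratLt (.ratOf .head) hr.weakenN)
  refine (CptP.exists (p := fun i c => x i ≤ ratOf c ∧ ratOf c < r i) h1).not.of_iff fun i => ?_
  rw [← not_lt, not_iff_not]
  constructor
  · intro h
    obtain ⟨q, hq, hq'⟩ := exists_rat_btwn h
    obtain ⟨c, rfl⟩ := ratOf_surjective q
    exact ⟨c, hq.le, by exact_mod_cast hq'⟩
  · rintro ⟨c, h1, h2⟩
    exact h1.trans_lt (by exact_mod_cast h2)

theorem CptR.eq [HasE A] {x y : ι → ℝ} (hx : CptR A x) (hy : CptR A y) :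
    CptP A fun i => x i = y i := by
  have h1 := (hx.weakenN.le (.ratOf .head)).iff (hy.weakenN.le (.ratOf .head))
  refine (CptP.forall (p := fun i c => x i ≤ ratOf c ↔ y i ≤ ratOf c) h1).of_iff fun i => ?_
  refine ⟨fun h c => by rw [h], fun h => ?_⟩
  have key : ∀ u v : ℝ, (∀ c, u ≤ ratOf c → v ≤ ratOf c) → v ≤ u := by
    intro u v huv
    by_contra! hlt
    obtain ⟨q, hq, hq'⟩ := exists_rat_btwn hlt
    obtain ⟨c, rfl⟩ := ratOf_surjective q
    exact absurd (huv c hq.le) (not_le.2 hq')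
  exact le_antisymm (key _ _ fun c => (h c).2) (key _ _ fun c => (h c).1)

/-! ### Semicontinuous functions, Baire class 1 and oscillation -/

/-- The approximations sup_y (h(y) - n·d(x, y)) are n-Lipschitz and at least h(x). Near x,
semicontinuity bounds h(y); at distance at least δ, the penalty exceeds 1 ≥ h(y) once nδ > 1. -/
theorem UpperSemicontinuous.isBaireOne {h : unitInterval → ℝ} (hh : UpperSemicontinuous h)
    (h0 : ∀ x, 0 ≤ h x) (h1 : ∀ x, h x ≤ 1) : IsBaireOne h := by
  have hb : ∀ (n : ℕ) x, BddAbove (Set.range fun y => h y - n * dist x y) := fun n x =>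
    ⟨1, by rintro _ ⟨y, rfl⟩; have := h1 y; have : 0 ≤ n * dist x y := by positivity
           linarith⟩
  refine ⟨fun n x => ⨆ y, (h y - n * dist x y), fun n => ?_, fun x => ?_⟩
  · refine (LipschitzWith.of_le_add_mul (n : NNReal) fun x x' => ?_).continuous
    refine ciSup_le fun y => ?_
    have h2 := le_ciSup (hb n x') y
    have h3 : (n : ℝ) * dist x' y ≤ n * (dist x x' + dist x y) := by
      gcongr
      exact dist_comm x x' ▸ dist_triangle x' x y
    have : ((n : NNReal) : ℝ) = n := rfl
    rw [this]
    linarith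
  · have hle : ∀ n : ℕ, h x ≤ ⨆ y, (h y - n * dist x y) := fun n => by
      simpa using le_ciSup (hb n x) x
    rw [Metric.tendsto_atTop]
    intro ε hε
    obtain ⟨δ, hδ, hδ'⟩ := Metric.eventually_nhds_iff.1 (hh x (h x + ε / 2) (by linarith))
    obtain ⟨N, hN⟩ := exists_nat_gt (1 / δ)
    refine ⟨N, fun n hn => ?_⟩
    have : (⨆ y, (h y - n * dist x y)) ≤ h x + ε / 2 := ciSup_le fun y => by
      by_cases hy : dist y x < δ
      · have := hδ' hy
        have : 0 ≤ n * dist x y := by positivity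
        linarith
      · have h2 : 1 < (n : ℝ) * δ := by
          have : (N : ℝ) ≤ n := by exact_mod_cast hn
          rw [div_lt_iff₀ hδ] at hN
          nlinarith
        have h3 : (n : ℝ) * δ ≤ n * dist x y := by
          gcongr
          rw [dist_comm]
          exact not_lt.1 hy
        linarith [h0 x, h1 y]
    rw [Real.dist_eq, abs_lt]
    constructor <;> linarith [hle n]

/-- Every ball contains a zero of h, so all infima are 0; semicontinuity makes the suprema tend to
h(x). -/
theorem UpperSemicontinuous.isOscillationOf {h : unitInterval → ℝ} (hh : UpperSemicontinuous h)
    (h0 : ∀ x, 0 ≤ h x) (hd : Dense {x | h x = 0}) : IsOscillationOf h h := by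
  intro x
  have hinf : ∀ k : ℕ, (⨅ y ∈ Metric.ball x (1 / 2 ^ k), (h y : EReal)) = 0 := by
    intro k
    refine le_antisymm ?_ (le_iInf₂ fun y _ => by exact_mod_cast h0 y)
    obtain ⟨y, hy, hy'⟩ := Metric.dense_iff.1 hd x (1 / 2 ^ k) (by positivity)
    refine (iInf₂_le y hy).trans ?_
    rw [show h y = 0 from hy']
    simp
  simp only [hinf, sub_zero]
  have hle : ∀ k : ℕ, (h x : EReal) ≤ ⨆ y ∈ Metric.ball x (1 / 2 ^ k), (h y : EReal) := fun k =>
    le_iSup₂_of_le x (Metric.mem_ball_self (by positivity)) le_rfl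
  rw [tendsto_order]
  refine ⟨fun a ha => .of_forall fun k => ha.trans_le (hle k), fun a ha => ?_⟩
  obtain ⟨b, hb, hba⟩ := EReal.lt_iff_exists_real_btwn.1 ha
  obtain ⟨δ, hδ, hδ'⟩ := Metric.eventually_nhds_iff.1 (hh x b (by exact_mod_cast hb))
  filter_upwards [tendsto_one_div_two_pow.eventually_lt_const hδ] with k hk
  refine lt_of_le_of_lt (iSup₂_le fun y hy => ?_) hba
  exact_mod_cast (hδ' ((Metric.mem_ball.1 hy).trans hk)).le

theorem dense_preimage_unitInterval {D : Set ℝ} (hD : Dense D) :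
    Dense {x : unitInterval | (x : ℝ) ∈ D} := by
  rw [Metric.dense_iff]
  intro x ε hε
  have hx := x.2
  -- This open interval is non-empty even if x is an endpoint of [0,1].
  obtain ⟨y, hy, hy'⟩ := hD.exists_between (x := max 0 (x - ε : ℝ)) (y := min 1 (x + ε : ℝ)) (by
    simp only [lt_min_iff, max_lt_iff]
    refine ⟨⟨by norm_num, by linarith [hx.2]⟩, by linarith [hx.1], by linarith⟩)
  simp only [Set.mem_Ioo, lt_min_iff, max_lt_iff] at hy'
  refine ⟨⟨y, hy'.1.1.le, hy'.2.1.le⟩, ?_, hy⟩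
  rw [Metric.mem_ball, Subtype.dist_eq, Real.dist_eq, abs_lt]
  constructor
  · linarith [hy'.1.2]
  · linarith [hy'.2.2]

/-! ### The function with prescribed points of oscillation -/

open Classical in
/-- A code of `2⁻ⁿ` for the least `n` with `x ∉ O n`, and a code of `0` if there is none. -/
noncomputable def exitCode (O : ℕ → Set ℝ) (x : ℝ) : ℕ :=
  if ∃ n, x ∉ O n then Nat.pair (Nat.pair 1 0) (2 ^ sInf {n | x ∉ O n} - 1) else 0

/-- The value `2⁻ⁿ` for the least `n` with `x ∉ O n`, and `0` if there is none. -/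
noncomputable def exitFun (O : ℕ → Set ℝ) (x : ℝ) : ℝ := (ratOf (exitCode O x) : ℝ)

theorem exitFun_of_mem {O : ℕ → Set ℝ} {x : ℝ} (h : ∀ n, x ∈ O n) : exitFun O x = 0 := by
  simp [exitFun, exitCode, h, ratOf_zero]

theorem exitFun_of_not_mem {O : ℕ → Set ℝ} {x : ℝ} (h : ∃ n, x ∉ O n) :
    exitFun O x = 1 / 2 ^ sInf {n | x ∉ O n} := by
  rw [exitFun, exitCode, if_pos h, ratOf_pair, Nat.cast_sub Nat.one_le_two_pow]
  simp

theorem exitFun_nonneg (O : ℕ → Set ℝ) (x : ℝ) : 0 ≤ exitFun O x := by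
  by_cases h : ∃ n, x ∉ O n
  · rw [exitFun_of_not_mem h]; positivity
  · rw [exitFun_of_mem (by simpa using h)]

theorem exitFun_le {O : ℕ → Set ℝ} {x : ℝ} {k : ℕ} (hk : ∀ m < k, x ∈ O m) :
    exitFun O x ≤ 1 / 2 ^ k := by
  by_cases h : ∃ n, x ∉ O n
  · rw [exitFun_of_not_mem h]
    have : k ≤ sInf {n | x ∉ O n} := by
      by_contra! hlt
      exact Nat.sInf_mem (s := {n | x ∉ O n}) h (hk _ hlt)
    gcongr
    norm_num
  · rw [exitFun_of_mem (by simpa using h)]; positivity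

theorem le_exitFun_iff {O : ℕ → Set ℝ} {x : ℝ} {n : ℕ} :
    1 / 2 ^ n ≤ exitFun O x ↔ ∃ m ≤ n, x ∉ O m := by
  constructor
  · intro h
    by_contra! hc
    have h1 := h.trans (exitFun_le (k := n + 1) fun m hm => hc m (by omega))
    have h2 : (1 : ℝ) / 2 ^ (n + 1) < 1 / 2 ^ n := by
      gcongr
      · norm_num
      · omega
    linarith
  · rintro ⟨m, hm, hx⟩
    rw [exitFun_of_not_mem ⟨m, hx⟩]
    have : sInf {n | x ∉ O n} ≤ n := (Nat.sInf_le (s := {n | x ∉ O n}) hx).trans hm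
    gcongr
    norm_num

theorem isOpen_forall_le {O : ℕ → Set ℝ} (hO : ∀ n, IsOpen (O n)) (k : ℕ) :
    IsOpen {x | ∀ m < k, x ∈ O m} := by
  have : {x | ∀ m < k, x ∈ O m} = ⋂ m ∈ Finset.range k, O m := by ext; simp
  rw [this]
  exact isOpen_biInter_finset fun m _ => hO m

theorem upperSemicontinuous_exitFun {O : ℕ → Set ℝ} (hO : ∀ n, IsOpen (O n)) :
    UpperSemicontinuous (exitFun O) := by
  intro x c hc
  obtain ⟨k, hk, hkc⟩ : ∃ k : ℕ, (∀ m < k, x ∈ O m) ∧ (1 : ℝ) / 2 ^ k < c := by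
    by_cases h : ∃ n, x ∉ O n
    · rw [exitFun_of_not_mem h] at hc
      exact ⟨_, fun m hm => by simpa using Nat.notMem_of_lt_sInf hm, hc⟩
    · rw [exitFun_of_mem (by simpa using h)] at hc
      obtain ⟨k, hk⟩ := (tendsto_one_div_two_pow.eventually_lt_const hc).exists
      exact ⟨k, fun m _ => by simpa using not_exists.1 h m, hk⟩
  filter_upwards [(isOpen_forall_le hO k).mem_nhds hk] with y hy
  exact (exitFun_le hy).trans_lt hkc

/-- The representation of `exitFun O` by constant names. -/
noncomputable def exitRep (O : ℕ → Set ℝ) (α : ℕ → ℕ) (_ : ℕ) : ℕ := exitCode O (realOf α)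

/-- The values are rational, so constant names suffice, and `exitRep` is total as S8 requires. -/
theorem represents_exitRep (O : ℕ → Set ℝ) :
    Represents (exitRep O) fun x : unitInterval => exitFun O x := by
  rintro α x hx
  have h : realOf (exitRep O α) = exitFun O (realOf α) := realOf_const _
  rw [h, hx]

open Classical in
/-- A sequence is replaced by a name of `0` unless it names a real in `[0,1]`. -/
noncomputable def clip (α : ℕ → ℕ) : ℕ → ℕ :=
  fun n => if 0 ≤ realOf α ∧ realOf α ≤ 1 then α n else 0

theorem clip_of_mem {α : ℕ → ℕ} (h : 0 ≤ realOf α ∧ realOf α ≤ 1) : clip α = α := by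
  funext n
  simp [clip, h]

theorem realOf_clip_mem (α : ℕ → ℕ) : realOf (clip α) ∈ unitInterval := by
  by_cases h : 0 ≤ realOf α ∧ realOf α ≤ 1
  · rw [clip_of_mem h]; exact h
  · have : clip α = fun _ => 0 := by funext n; simp [clip, h]
    rw [this, realOf_const, ratOf_zero]
    simp

/-- The type of functionals that map representations of two functions and a number to a
representation of a function. -/
abbrev OscType : FinType := .arrow .realFun (.arrow .realFun (.arrow .zero .realFun))

open Classical in
/-- The values of `Γ` at `exitFun O`, made total outside the names of reals in `[0,1]`. -/
noncomputable def oscRep (Γ : PObj OscType) (O : ℕ → Set ℝ) (n : ℕ) (α : ℕ → ℕ) (k : ℕ) : ℕ :=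
  Part.getOrElse (Γ (exitRep O) (exitRep O) n (clip α) k : Part ℕ) 0

/-- The specification of Γ guarantees values only at names of points of [0,1]. Clipping the argument
makes the functional total without changing it at those names, so it can in turn be passed to Δ. -/
theorem IsOscComplementR2.exists_isR2 {Γ : PObj OscType} (hΓ : IsOscComplementR2 Γ)
    {O : ℕ → Set ℝ} (hO : ∀ n, IsOpen (O n)) (hd : ∀ n, Dense (O n)) (n : ℕ) :
    (∀ α k, (Γ (exitRep O) (exitRep O) n (clip α) k : Part ℕ) = Part.some (oscRep Γ O n α k)) ∧
    ∃ Y : unitInterval → unitInterval, IsR2 {x | ∀ m ≤ n, (x : ℝ) ∈ O m} Y ∧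
      Represents (oscRep Γ O n) fun x => Y x := by
  have husc : UpperSemicontinuous fun x : unitInterval => exitFun O x := fun x c hc =>
    continuous_subtype_val.continuousAt.eventually (upperSemicontinuous_exitFun hO x c hc)
  have h0 : ∀ x : unitInterval, 0 ≤ exitFun O x := fun x => exitFun_nonneg O x
  have h1 : ∀ x : unitInterval, exitFun O x ≤ 1 := fun x => by
    simpa using exitFun_le (O := O) (x := x) (k := 0) (by simp)
  -- The Baire category theorem enters only here and in similar verifications, not in the
  -- computation.
  have hdense : Dense {x : unitInterval | exitFun O x = 0} :=
    (dense_preimage_unitInterval (dense_iInter_of_isOpen hO hd)).mono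
      fun x (hx : (x : ℝ) ∈ ⋂ n, O n) => exitFun_of_mem fun n => Set.mem_iInter.1 hx n
  obtain ⟨Y, hY, hp⟩ := hΓ _ _ (UpperSemicontinuous.isBaireOne husc h0 h1)
    (UpperSemicontinuous.isOscillationOf husc h0 hdense) _ _ (represents_exitRep O)
    (represents_exitRep O) n
  have hset : {x : unitInterval | (1 : ℝ) / 2 ^ n ≤ exitFun O x}ᶜ =
      {x : unitInterval | ∀ m ≤ n, (x : ℝ) ∈ O m} := by
    ext x
    simp [-one_div, le_exitFun_iff]
  rw [hset] at hY
  have key : ∀ α k, (Γ (exitRep O) (exitRep O) n (clip α) k : Part ℕ) =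
      Part.some (oscRep Γ O n α k) := by
    intro α k
    obtain ⟨β, hβ, -⟩ := hp (clip α) ⟨_, realOf_clip_mem α⟩ rfl
    have h2 : (Γ (exitRep O) (exitRep O) n (clip α) k : Part ℕ) = Part.some (β k) := hβ k
    have h3 : oscRep Γ O n α k = β k := by
      simp only [oscRep]
      rw! [h2]
      exact dif_pos trivial
    rw [h2, h3]
  refine ⟨key, Y, hY, fun α x hx => ?_⟩
  obtain ⟨β, hβ, hβ'⟩ := hp α x hx
  rw [← hβ']
  congr 1
  funext k
  have h2 := key α k
  rw [clip_of_mem (by rw [hx]; exact x.2)] at h2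
  exact Part.some_inj.1 (h2.symm.trans (hβ k))

/-! ### Computability of these functions -/

theorem cpt_exitCode [HasE A] {O : ι → ℕ → Set ℝ} {x : ι → ℝ}
    (h : CptP (pushN A) fun p => x p.1 ∈ O p.1 p.2) : Cpt A fun i => exitCode (O i) (x i) :=
  Cpt.ite (CptP.exists (p := fun i n => x i ∉ O i n) h.not)
    (((Cpt.const 1).pair (.const 0)).pair
      ((Cpt.sInf (p := fun i n => x i ∉ O i n) h.not).two_pow.sub (.const 1))) (.const 0)

theorem cptS_clip [HasE A] {a : ι → ℕ → ℕ} (ha : CptS A a) : CptS A fun i => clip (a i) := by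
  have h0 : CptP A fun i => 0 ≤ realOf (a i) := by
    simpa using CptR.rat_le ha.cptR (.const 0)
  have h1 : CptP A fun i => realOf (a i) ≤ 1 := by
    simpa using CptR.le ha.cptR (.const 1)
  classical
  have h := Cpt.ite (h0.and h1).weakenN ha (.const 0)
  unfold CptS clip
  convert h using 3

theorem cptS_oscRep [HasE A] {Γ : ι → PObj OscType} (hA : (fun i => Arg.fn _ _ (Γ i)) ∈ A)
    (hΓ : ∀ i, IsOscComplementR2 (Γ i)) {O : ι → ℕ → Set ℝ} (hO : ∀ i n, IsOpen (O i n))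
    (hd : ∀ i n, Dense (O i n))
    (hOA : CptP (pushN (pushS A)) fun q => realOf q.1.2 ∈ O q.1.1 q.2)
    {n : ι → ℕ} (hn : Cpt A n) {a : ι → ℕ → ℕ} (ha : CptS A a) :
    CptS A fun i => oscRep (Γ i) (O i) (n i) (a i) := by
  have h1 : Abs .realFun A fun i => exitRep (O i) :=
    Abs.lamSS (a := fun i => exitRep (O i))
      (CptS.const (cpt_exitCode (O := fun q : ι × (ℕ → ℕ) => O q.1) hOA))
  have h3 := h1.weakenN
  refine Cpt.oracle (mem_pushN hA) ⟨_, h3, _, h3, _, hn.weakenN, _, (cptS_clip ha).weakenN.abs,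
    fun p => p.2, Cpt.head, fun p => ?_⟩
  exact Part.eq_some_iff.1 (((hΓ p.1).exists_isR2 (hO p.1) (hd p.1) (n p.1)).1 (a p.1) p.2)

theorem charFun_eq_zero {S : Set ℝ} {α : ℕ → ℕ} : charFun S α = 0 ↔ realOf α ∉ S := by
  simp [charFun]

theorem CptR.mem {S : ι → Set ℝ} (hA : (fun i => Arg.ofObj .set (charFun (S i))) ∈ A)
    {x : ι → ℝ} (hx : CptR A x) : CptP A fun i => x i ∈ S i := by
  obtain ⟨a, ha, hx⟩ := hx
  have h : Cpt A fun i => charFun (S i) (a i) :=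
    Cpt.oracle hA ⟨a, ha.abs, fun i => Part.mem_some _⟩
  exact (CptP.eq_zero h).not.of_iff fun i => by rw [charFun_eq_zero, not_not, hx]

theorem CptR.mem_seq {O : ι → ℕ → Set ℝ}
    (hA : (fun i => Arg.ofObj (.arrow .zero .set) fun n => charFun (O i n)) ∈ A)
    {n : ι → ℕ} (hn : Cpt A n) {x : ι → ℝ} (hx : CptR A x) : CptP A fun i => x i ∈ O i (n i) := by
  obtain ⟨a, ha, hx⟩ := hx
  have h : Cpt A fun i => charFun (O i (n i)) (a i) :=
    Cpt.oracle hA ⟨n, hn, a, ha.abs, fun i => Part.mem_some _⟩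
  exact (CptP.eq_zero h).not.of_iff fun i => by rw [charFun_eq_zero, not_not, hx]

/-! ### Nested intervals -/

/-- The centre of the interval with code `s`. -/
def centre (s : ℕ) : ℚ := ratOf s.unpair.1

/-- The radius of the interval with code `s`. -/
def radius (s : ℕ) : ℚ := 1 / 2 ^ s.unpair.2

theorem radius_pos (s : ℕ) : 0 < radius s := by unfold radius; positivity

/-- The interval with code `t` is well inside the one with code `s`, and its radius is at most the
value of `f` at the code of its centre. -/
def Refines (f : ℕ → ℝ) (s t : ℕ) : Prop :=
  |centre t - centre s| < radius s - radius t ∧ (radius t : ℝ) ≤ f t.unpair.1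

/-- The interval with code `s` is contained in `[0,1]`. -/
def InUnit (s : ℕ) : Prop := radius s ≤ centre s ∧ centre s ≤ 1 - radius s

theorem Refines.inUnit {f : ℕ → ℝ} {s t : ℕ} (h : Refines f s t) (hs : InUnit s) : InUnit t := by
  have h1 := abs_lt.1 h.1
  have h2 := hs.1
  have h3 := hs.2
  constructor <;> linarith [h1.1, h1.2]

section NestedIntervals

variable {f : ℕ → ℕ → ℝ} {u : ℕ → ℕ} (hu : ∀ n, Refines (f n) (u n) (u (n + 1)))

include hu in
theorem abs_centre_sub_le {i j : ℕ} (hij : i ≤ j) :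
    |centre (u j) - centre (u i)| ≤ radius (u i) - radius (u j) := by
  induction j, hij using Nat.le_induction with
  | base => simp
  | succ j _ ih =>
    have h1 := (hu j).1
    have h2 := abs_sub_le (centre (u (j + 1))) (centre (u j)) (centre (u i))
    linarith

include hu in
-- The radii are powers of 1/2 and strictly decrease, so the exponent grows at every stage.
theorem radius_le (n : ℕ) : radius (u n) ≤ 1 / 2 ^ n := by
  have h : n ≤ (u n).unpair.2 := by
    induction n with
    | zero => exact Nat.zero_le _
    | succ n ih =>
      have h1 : radius (u (n + 1)) < radius (u n) := by
        have := (abs_nonneg _).trans_lt (hu n).1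
        linarith
      have h2 : (u n).unpair.2 < (u (n + 1)).unpair.2 := by
        by_contra! h3
        refine absurd h1 (not_lt.2 ?_)
        unfold radius
        gcongr
        norm_num
      omega
  unfold radius
  gcongr
  norm_num

/-- The centres of the intervals, as a sequence of codes of rationals. -/
def centres (u : ℕ → ℕ) (n : ℕ) : ℕ := (u n).unpair.1

include hu in
theorem abs_realOf_centres_sub_le (i : ℕ) :
    |realOf (centres u) - centre (u i)| ≤ radius (u i) := by
  have hfast : ∀ N, FastUpTo (fun k => ratOf (centres u k)) N := by
    intro N j _ i hi
    have h1 := abs_centre_sub_le hu hi.le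
    have h2 := radius_le hu i
    have h3 := radius_pos (u j)
    rw [abs_sub_comm] at h1
    exact lt_of_le_of_lt h1 (by linarith)
  have h1 := ((tendsto_realOf (centres u)).sub_const ((centre (u i) : ℚ) : ℝ)).abs
  refine le_of_tendsto h1 ?_
  filter_upwards [Filter.eventually_ge_atTop i] with j hj
  rw [hat_eq_self j (hfast j)]
  have h2 := abs_centre_sub_le hu hj
  have h3 := radius_pos (u j)
  have h4 : |centre (u j) - centre (u i)| ≤ radius (u i) := by linarith
  have h5 := (Rat.cast_le (K := ℝ)).2 h4
  push_cast at h5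
  exact h5

include hu in
-- Strictness comes from the next interval lying well inside; it is needed because
-- R2-representations provide open intervals.
theorem abs_realOf_centres_sub_lt (i : ℕ) :
    |realOf (centres u) - centre (u i)| < radius (u i) := by
  have h1 := (Rat.cast_lt (K := ℝ)).2 (hu i).1
  push_cast at h1
  have h2 := abs_realOf_centres_sub_le hu (i + 1)
  have h3 := abs_sub_le (realOf (centres u)) (centre (u (i + 1))) (centre (u i))
  linarith

end NestedIntervals

theorem InUnit.mem {s : ℕ} (hs : InUnit s) {x : ℝ} (hx : |x - centre s| ≤ radius s) :
    x ∈ unitInterval := by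
  have h1 := abs_le.1 hx
  have h2 := (Rat.cast_le (K := ℝ)).2 hs.1
  have h3 := (Rat.cast_le (K := ℝ)).2 hs.2
  push_cast at h3
  constructor <;> linarith [h1.1, h1.2]

theorem InUnit.centre_mem {s : ℕ} (hs : InUnit s) : (centre s : ℝ) ∈ unitInterval :=
  hs.mem (by simpa using (radius_pos s).le)

/-- A rational point of O in the open interval serves as centre; a small enough power of 1/2 meets
both bounds on the radius. -/
theorem InUnit.exists_refines {O : Set ℝ} (hO : IsOpen O) (hd : Dense O) {f : ℕ → ℝ}
    (hf : ∀ c, (ratOf c : ℝ) ∈ unitInterval → (ratOf c : ℝ) ∈ O → 0 < f c) {s : ℕ} (hs : InUnit s) :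
    ∃ t, Refines f s t := by
  have hpos : (0 : ℝ) < radius s := by exact_mod_cast radius_pos s
  obtain ⟨q, hq, hqO⟩ := Rat.denseRange_cast.exists_mem_open
    (Metric.isOpen_ball.inter hO) (hd.inter_open_nonempty (Metric.ball (centre s : ℝ) (radius s))
      Metric.isOpen_ball ⟨_, Metric.mem_ball_self hpos⟩)
  rw [Metric.mem_ball, Real.dist_eq] at hq
  obtain ⟨c, rfl⟩ := ratOf_surjective q
  have h1 : 0 < min ((radius s : ℝ) - |(ratOf c : ℝ) - centre s|) (f c) :=
    lt_min (by linarith) (hf c (hs.mem hq.le) hqO)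
  obtain ⟨m, hm⟩ := (tendsto_one_div_two_pow.eventually_lt_const h1).exists
  have hc : centre (Nat.pair c m) = ratOf c := by simp [centre]
  have hr : radius (Nat.pair c m) = 1 / 2 ^ m := by simp [radius]
  refine ⟨Nat.pair c m, ?_, ?_⟩
  · rw [hc, hr]
    refine (Rat.cast_lt (K := ℝ)).1 ?_
    push_cast
    linarith [hm.trans_le (min_le_left _ _)]
  · rw [hr, Nat.unpair_pair]
    push_cast
    exact (hm.trans_le (min_le_right _ _)).le

/-! ### A Baire realiser -/

/-- The value at the rational with code `c` of the representation that `Γ` yields. -/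
noncomputable def oscVal (Γ : PObj OscType) (O : ℕ → Set ℝ) (n c : ℕ) : ℝ :=
  realOf (oscRep Γ O n fun _ => c)

theorem cptP_refines_oscVal [HasE A] {Γ : ι → PObj OscType}
    (hA : (fun i => Arg.fn _ _ (Γ i)) ∈ A) (hΓ : ∀ i, IsOscComplementR2 (Γ i))
    {O : ι → ℕ → Set ℝ}
    (hOA : (fun i => Arg.ofObj (.arrow .zero .set) fun n => charFun (O i n)) ∈ A)
    (hO : ∀ i n, IsOpen (O i n)) (hd : ∀ i n, Dense (O i n)) {n s t : ι → ℕ}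
    (hn : Cpt A n) (hs : Cpt A s) (ht : Cpt A t) :
    CptP A fun i => Refines (oscVal (Γ i) (O i) (n i)) (s i) (t i) := by
  have hmem := CptR.mem_seq (O := fun q : (ι × (ℕ → ℕ)) × ℕ => O q.1.1)
    (mem_pushN (mem_pushS hOA)) .head CptS.head.weakenN.cptR
  have h1 := cptS_oscRep hA hΓ hO hd hmem hn (.const ht.fst)
  exact (CptP.absLt ((CptQ.ratOf ht.fst).sub (.ratOf hs.fst))
    ((CptQ.inv_two_pow hs.snd).sub (.inv_two_pow ht.snd))).and
    ((CptR.rat_le h1.cptR (.inv_two_pow ht.snd)))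

/-- Each stage takes the least admissible code. If there is none, `sInf` returns 0, and nothing is
claimed about that stage. -/
theorem exists_cptS_chain [HasE A] {R : ι → ℕ → ℕ → ℕ → Prop}
    (hR : CptP (pushN (pushN (pushN (pushN A)))) fun r => R r.1.1.1.1 r.1.2 r.1.1.2 r.2) (c : ℕ) :
    ∃ u : ι → ℕ → ℕ, CptS A u ∧ ∀ i, u i 0 = c ∧
      ∀ n, (∃ t, R i n (u i n) t) → R i n (u i n) (u i (n + 1)) :=
  ⟨fun i n => Nat.rec (motive := fun _ => ℕ) c (fun n s => sInf {t | R i n s t}) n,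
    Cpt.natRec (s := fun (p : ι × ℕ) n s => sInf {t | R p.1 n s t}) (.const _)
      (Cpt.sInf (p := fun (q : ((ι × ℕ) × ℕ) × ℕ) t => R q.1.1.1 q.2 q.1.2 t) hR) .head,
    fun _ => ⟨rfl, fun _ h => Nat.sInf_mem h⟩⟩

theorem exists_cptS_mem_of_dense [HasE A] {Γ : ι → PObj OscType}
    (hA : (fun i => Arg.fn _ _ (Γ i)) ∈ A) (hΓ : ∀ i, IsOscComplementR2 (Γ i))
    {O : ι → ℕ → Set ℝ}
    (hOA : (fun i => Arg.ofObj (.arrow .zero .set) fun n => charFun (O i n)) ∈ A)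
    (hO : ∀ i n, IsOpen (O i n)) (hd : ∀ i n, Dense (O i n)) :
    ∃ γ : ι → ℕ → ℕ, CptS A γ ∧ ∀ i n, realOf (γ i) ∈ O i n := by
  have hy : CptP (pushN (pushN (pushN (pushN A))))
      fun r => Refines (oscVal (Γ r.1.1.1.1) (O r.1.1.1.1) r.1.2) r.1.1.2 r.2 :=
    cptP_refines_oscVal (Γ := fun r : (((ι × ℕ) × ℕ) × ℕ) × ℕ => Γ r.1.1.1.1)
      (O := fun r : (((ι × ℕ) × ℕ) × ℕ) × ℕ => O r.1.1.1.1)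
      (mem_pushN (mem_pushN (mem_pushN (mem_pushN hA)))) (fun r => hΓ r.1.1.1.1)
      (mem_pushN (mem_pushN (mem_pushN (mem_pushN hOA)))) (fun r => hO r.1.1.1.1)
      (fun r => hd r.1.1.1.1) Cpt.head.weakenN Cpt.head.weakenN.weakenN .head
  -- Centre 1/2 and radius 2⁻¹: the chain starts with the whole of [0,1].
  obtain ⟨c, hc⟩ := ratOf_surjective (1 / 2)
  obtain ⟨u, hu, huR⟩ := exists_cptS_chain
    (R := fun i n => Refines (oscVal (Γ i) (O i) n)) hy (Nat.pair c 1)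
  have hstep : ∀ i n, InUnit (u i n) → Refines (oscVal (Γ i) (O i) n) (u i n) (u i (n + 1)) := by
    intro i n hin
    obtain ⟨-, Y, hY, hYr⟩ := (hΓ i).exists_isR2 (hO i) (hd i) n
    have hopen := isOpen_forall_le (hO i) (n + 1)
    have hdense : Dense {x | ∀ m < n + 1, x ∈ O i m} :=
      (dense_iInter_of_isOpen (hO i) (hd i)).mono fun x hx m _ => Set.mem_iInter.1 hx m
    refine (huR i).2 n (hin.exists_refines hopen hdense fun d hd1 hd2 => ?_)
    have h1 : oscVal (Γ i) (O i) n d = Y ⟨ratOf d, hd1⟩ := hYr _ ⟨ratOf d, hd1⟩ (realOf_const d)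
    rw [h1]
    have h2 : (⟨ratOf d, hd1⟩ : unitInterval) ∈ {x : unitInterval | ∀ m ≤ n, (x : ℝ) ∈ O i m} :=
      fun m hm => hd2 m (Nat.lt_succ_of_le hm)
    rw [hY.1] at h2
    exact h2
  have h0 : ∀ i, InUnit (u i 0) := fun i => by
    simp only [InUnit, radius, centre, (huR i).1, Nat.unpair_pair, hc]
    norm_num
  have hin : ∀ i n, InUnit (u i n) := fun i n => by
    induction n with
    | zero => exact h0 i
    | succ n ih => exact (hstep i n ih).inUnit ih
  have href : ∀ i n, Refines (oscVal (Γ i) (O i) n) (u i n) (u i (n + 1)) := fun i n =>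
    hstep i n (hin i n)
  refine ⟨fun i => centres (u i), Cpt.fst hu, fun i n => ?_⟩
  obtain ⟨-, Y, hY, hYr⟩ := (hΓ i).exists_isR2 (hO i) (hd i) n
  -- Interval n + 1 is the one whose radius is bounded by Y_n at its centre; the limit lies strictly
  -- inside it.
  have hlt := abs_realOf_centres_sub_lt (href i) (n + 1)
  have hcm := (hin i (n + 1)).centre_mem
  have hxm := (hin i (n + 1)).mem hlt.le
  have h1 : oscVal (Γ i) (O i) n (u i (n + 1)).unpair.1 = Y ⟨_, hcm⟩ :=
    hYr _ ⟨_, hcm⟩ (realOf_const _)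
  have h2 := (href i n).2
  rw [h1] at h2
  have h3 : (0 : ℝ) < Y ⟨_, hcm⟩ :=
    lt_of_lt_of_le (by exact_mod_cast radius_pos (u i (n + 1))) h2
  have h4 := abs_lt.1 hlt
  have h5 : (⟨_, hxm⟩ : unitInterval) ∈ {x : unitInterval | ∀ m ≤ n, (x : ℝ) ∈ O i m} :=
    hY.2 ⟨_, hcm⟩ h3 ⟨by dsimp only; linarith [h4.1], by dsimp only; linarith [h4.2]⟩
  exact h5 n le_rfl

theorem CptS.uncurry {a : ι → ℕ → ℕ → ℕ} (h : CptS (pushN A) fun p => a p.1 p.2) :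
    CptS A fun i j => a i j.unpair.1 j.unpair.2 := by
  have h1 : Abs (.arrow .zero (.arrow .zero .zero)) A a := h
  have h2 : Cpt (pushN (pushN (pushN A))) fun q => a q.1.1.1 q.1.2 q.2 := h1.weakenN
  have h3 : Cpt (pushN (pushN A)) fun q => a q.1.1 q.2 q.1.2.unpair.2 :=
    Cpt.bind (h := fun (q : (ι × ℕ) × ℕ) => a q.1.1 q.2) h2 Cpt.head.snd.weakenN
  exact Cpt.bind (h := fun (p : ι × ℕ) m => a p.1 m p.2.unpair.2) h3 Cpt.head.fst

/-! ### A finiteness realiser -/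

/-- The type of functionals that map representations of functions to representations. -/
abbrev TransType : FinType := .arrow .realFun .realFun

/-- The nearest point of a set on the right, from the distance function at `0`. -/
theorem exists_rat_infDist_eq {X : Set ℝ} (hX : X.Finite) {x : ℝ} (hx : x ∈ X) :
    ∃ s : ℚ, ∀ C : Set unitInterval, (∀ u : unitInterval, u ∈ C ↔ (u : ℝ) + s ∈ X) →
      C.Nonempty ∧ Metric.infDist 0 C = x - s := by
  have h1 : (X \ {x})ᶜ ∈ nhds x :=
    (hX.subset Set.sdiff_subset).isClosed.isOpen_compl.mem_nhds (by simp)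
  obtain ⟨ε, hε, hb⟩ := Metric.mem_nhds_iff.1 h1
  -- s > x - 1 puts x - s in [0,1], and s > x - ε excludes other points of X from [s, x].
  obtain ⟨s, hs, hsx⟩ := exists_rat_btwn (max_lt (sub_lt_self x hε) (sub_lt_self x one_pos))
  rw [max_lt_iff] at hs
  refine ⟨s, fun C hC => ?_⟩
  have hxs : x - s ∈ unitInterval := ⟨by linarith, by linarith⟩
  have hmem : (⟨x - s, hxs⟩ : unitInterval) ∈ C := (hC _).2 (by simpa using hx)
  have hdist : ∀ u : unitInterval, dist 0 u = (u : ℝ) := fun u => by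
    rw [Subtype.dist_eq, dist_comm, Real.dist_eq]
    simp [abs_of_nonneg u.2.1]
  refine ⟨⟨_, hmem⟩, le_antisymm ?_ ?_⟩
  · exact (Metric.infDist_le_dist_of_mem hmem).trans_eq (hdist _)
  · refine (Metric.le_infDist ⟨_, hmem⟩).2 fun u hu => ?_
    rw [hdist]
    by_contra! hlt
    have h2 : (u : ℝ) + s ∈ (X \ {x})ᶜ := hb (by
      rw [Metric.mem_ball, Real.dist_eq, abs_lt]
      constructor <;> linarith [u.2.1])
    exact h2 ⟨(hC u).1 hu, fun h => by
      have : (u : ℝ) + s = x := h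
      linarith⟩

theorem exists_cptS_covering [HasE A] {Γ : ι → PObj OscType} {Δ : ι → PObj TransType}
    (hΓA : (fun i => Arg.fn _ _ (Γ i)) ∈ A) (hΔA : (fun i => Arg.fn _ _ (Δ i)) ∈ A)
    (hΓ : ∀ i, IsOscComplementR2 (Γ i)) (hΔ : ∀ i, IsR2ToR3 (Δ i)) {X : ι → Set ℝ}
    (hXA : (fun i => Arg.ofObj .set (charFun (X i))) ∈ A) (hX : ∀ i, (X i).Finite) :
    ∃ ζ : ι → ℕ → ℕ → ℕ, CptS (pushN A) (fun p => ζ p.1 p.2) ∧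
      ∀ i, ∀ x ∈ X i, ∃ s, realOf (ζ i s) = x := by
  let O : ι × ℕ → ℕ → Set ℝ := fun p _ => {y | y + ratOf p.2 ∉ X p.1}
  have hO' : ∀ p n, (O p n)ᶜ.Finite := fun p n => by
    have : (O p n)ᶜ = (fun y => y + (ratOf p.2 : ℝ)) ⁻¹' X p.1 := by ext; simp [O]
    rw [this]
    exact (hX p.1).preimage (add_left_injective _).injOn
  have hO : ∀ p n, IsOpen (O p n) := fun p n => isClosed_compl_iff.1 (hO' p n).isClosed
  have hd : ∀ p n, Dense (O p n) := fun p n => by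
    simpa using (hO' p n).countable.dense_compl ℝ
  have hmem : CptP (pushN (pushS (pushS (pushN A)))) fun q => realOf q.1.2 ∈ O q.1.1.1 q.2 := by
    have h1 : CptR (pushN (pushS (pushS (pushN A))))
        fun q => realOf q.1.2 + ratOf q.1.1.1.2 :=
      CptS.head.weakenN.cptR.add_rat (.ratOf Cpt.head.weakenS.weakenS.weakenN)
    exact (CptR.mem (S := fun q : (((ι × ℕ) × (ℕ → ℕ)) × (ℕ → ℕ)) × ℕ => X q.1.1.1.1)
      (mem_pushN (mem_pushS (mem_pushS (mem_pushN hXA)))) h1).not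
  let V : ι × ℕ → (ℕ → ℕ) → ℕ → ℕ := fun p => oscRep (Γ p.1) (O p) 0
  have hV : Abs .realFun (pushN A) V :=
    Abs.lamSS (a := V) (cptS_oscRep (Γ := fun q : (ι × ℕ) × (ℕ → ℕ) => Γ q.1.1)
      (O := fun q : (ι × ℕ) × (ℕ → ℕ) => O q.1) (n := fun _ => 0)
      (mem_pushS (mem_pushN hΓA)) (fun q => hΓ q.1.1)
      (fun q => hO q.1) (fun q => hd q.1) hmem (.const 0) .head)
  -- The value at 0 is defined for every s, even if X misses [s, s + 1]; the real obtained then is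
  -- superfluous but harmless.
  have hw : ∀ p : ι × ℕ, ∃ w : ℕ → ℕ,
      (∀ k, (Δ p.1 (V p) (fun _ => (0 : ℕ)) k : Part ℕ) = Part.some (w k)) ∧
      ∃ Z, IsR3 {u : unitInterval | ∀ m ≤ 0, (u : ℝ) ∈ O p m} Z ∧ realOf w = Z 0 := fun p => by
    obtain ⟨-, Y, hY, hYr⟩ := (hΓ p.1).exists_isR2 (hO p) (hd p) 0
    obtain ⟨Z, hZ, hZr⟩ := hΔ p.1 _ Y hY _ hYr
    obtain ⟨w, hw, hw'⟩ := hZr (fun _ => 0) 0 (by simp [realOf_const, ratOf_zero])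
    exact ⟨w, hw, Z, hZ, hw'⟩
  choose w hw hwZ using hw
  have hwS : CptS (pushN A) w :=
    Cpt.oracle (mem_pushN (mem_pushN hΔA)) ⟨_, hV.weakenN, fun _ _ => (0 : ℕ),
      CptS.abs (CptS.const (.const 0)), fun p => p.2, Cpt.head,
      fun q => Part.eq_some_iff.1 (hw q.1 q.2)⟩
  obtain ⟨ζ, hζ, hζw⟩ := hwS.cptR.add_rat (.ratOf .head)
  refine ⟨fun i s => ζ (i, s), hζ, fun i x hx => ?_⟩
  obtain ⟨s, hs⟩ := exists_rat_infDist_eq (hX i) hx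
  obtain ⟨c, rfl⟩ := ratOf_surjective s
  obtain ⟨Z, hZ, hZw⟩ := hwZ (i, c)
  obtain ⟨hne, hdist⟩ := hs {u : unitInterval | ∀ m ≤ 0, (u : ℝ) ∈ O (i, c) m}ᶜ (by simp [O])
  refine ⟨c, ?_⟩
  rw [hζw]
  dsimp only
  rw [hZw, hZ.2.2.1 hne, hdist]
  ring

theorem exists_cptS_enumeration [HasE A] {X : ι → Set ℝ}
    (hXA : (fun i => Arg.ofObj .set (charFun (X i))) ∈ A) (hX : ∀ i, (X i).Finite)
    {ζ : ι → ℕ → ℕ → ℕ} (hζ : CptS (pushN A) fun p => ζ p.1 p.2)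
    (hcov : ∀ i, ∀ x ∈ X i, ∃ s, realOf (ζ i s) = x) :
    ∃ γ : ι → ℕ → ℕ, CptS A γ ∧
      ∀ i, ∀ x ∈ X i, ∃ t < γ i 0, realOf (fun k => γ i (Nat.pair t k + 1)) = x := by
  classical
  let E : ι → ℕ → ℕ := fun i j => ζ i j.unpair.1 j.unpair.2
  have hE : CptS A E := hζ.uncurry
  -- The first N entries already contain every entry that lies in X. Such an N exists because X is
  -- finite, and ∃² decides whether a given N will do.
  let P : ι → ℕ → Prop := fun i N =>
    ∀ s, realOf (ζ i s) ∈ X i → ∃ t, t < N ∧ realOf (ζ i t) = realOf (ζ i s)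
  have hP : CptP (pushN A) fun p => P p.1 p.2 := by
    have hs : CptR (pushN (pushN A)) fun q => realOf (ζ q.1.1 q.2) :=
      ⟨fun q k => E q.1.1 (Nat.pair q.2 k), (hE.weakenN.weakenN.weakenN).app
        (Cpt.head.weakenN.pair .head), fun q => by simp [E]⟩
    have ht : CptR (pushN (pushN (pushN A))) fun q => realOf (ζ q.1.1.1 q.2) :=
      ⟨fun q k => E q.1.1.1 (Nat.pair q.2 k), (hE.weakenN.weakenN.weakenN.weakenN).app
        (Cpt.head.weakenN.pair .head), fun q => by simp [E]⟩
    have h1 := (CptP.lt .head Cpt.head.weakenN.weakenN).and (ht.eq hs.weakenN)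
    have h2 := CptP.exists (p := fun (q : (ι × ℕ) × ℕ) t =>
      t < q.1.2 ∧ realOf (ζ q.1.1 t) = realOf (ζ q.1.1 q.2)) h1
    exact CptP.forall (p := fun (p : ι × ℕ) s => realOf (ζ p.1 s) ∈ X p.1 →
      ∃ t, t < p.2 ∧ realOf (ζ p.1 t) = realOf (ζ p.1 s))
      ((CptR.mem (mem_pushN (mem_pushN hXA)) hs).imp h2)
  have hPex : ∀ i, ∃ N, P i N := by
    intro i
    choose! g hg using hcov i
    obtain ⟨N, hN⟩ := ((hX i).image g).bddAbove
    exact ⟨N + 1, fun s hs => ⟨g (realOf (ζ i s)),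
      Nat.lt_succ_of_le (hN (Set.mem_image_of_mem _ hs)), hg _ hs⟩⟩
  let N : ι → ℕ := fun i => sInf {n | P i n}
  have hN : Cpt A N := Cpt.least hP hPex
  -- Position 0 holds the length, which shifts the interleaved names by one. Entries outside X may
  -- remain in the list.
  refine ⟨fun i k => if k = 0 then N i else E i (k - 1),
    ?_, fun i x hx => ?_⟩
  · have h := Cpt.ite (CptP.eq_zero .head) hN.weakenN (hE.weakenN.app (Cpt.head.sub (.const 1)))
    convert h using 3
  obtain ⟨s, rfl⟩ := hcov i x hx
  obtain ⟨t, ht, hts⟩ := Nat.sInf_mem (s := {n | P i n}) (hPex i) s hx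
  exact ⟨t, by simpa [N] using ht, by simpa [E] using hts⟩

end HigherOrder

-- The two indices

theorem theorem3p3 :
    (∃ e : HigherOrder.Index,
      ∀ Γ : HigherOrder.PObj (.arrow .realFun (.arrow .realFun (.arrow .zero .realFun))),
        HigherOrder.IsOscComplementR2 Γ →
          HigherOrder.IsBaireRealiser (HigherOrder.computed e (.arrow (.arrow .zero .set) .one)
            [.ofObj (.arrow .one .zero) HigherOrder.existsTwo, .fn _ _ Γ])) ∧
    (∃ d : HigherOrder.Index,
      ∀ (Γ : HigherOrder.PObj (.arrow .realFun (.arrow .realFun (.arrow .zero .realFun))))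
        (Δ : HigherOrder.PObj (.arrow .realFun .realFun)),
        HigherOrder.IsOscComplementR2 Γ → HigherOrder.IsR2ToR3 Δ →
          HigherOrder.IsFinitenessRealiser (HigherOrder.computed d (.arrow .set .one)
            [.ofObj (.arrow .one .zero) HigherOrder.existsTwo, .fn _ _ Γ, .fn _ _ Δ])) := by
  open HigherOrder in
  constructor
  -- The family runs over all admissible inputs, so its single index depends on none of them. The
  -- input precedes ∃² and Γ in `A`, in the order that `computed` produces.
  · let ι := {p : PObj OscType × (ℕ → Set ℝ) //
      IsOscComplementR2 p.1 ∧ (∀ n, IsOpen (p.2 n)) ∧ ∀ n, Dense (p.2 n)}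
    let A : List (ι → Arg) := [fun i => .ofObj (.arrow .zero .set) fun n => charFun (i.1.2 n),
      fun _ => .ofObj (.arrow .one .zero) existsTwo, fun i => .fn _ _ i.1.1]
    have : HasE A := ⟨by simp [A]⟩
    obtain ⟨γ, ⟨e, he⟩, hmem⟩ := exists_cptS_mem_of_dense (A := A) (Γ := fun i => i.1.1)
      (O := fun i => i.1.2) (by simp [A]) (fun i => i.2.1) (by simp [A]) (fun i => i.2.2.1)
      (fun i => i.2.2.2)
    refine ⟨e, fun Γ hΓ O hO hd => ?_⟩
    let i : ι := ⟨(Γ, O), hΓ, hO, hd⟩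
    exact ⟨_, Set.mem_iInter.2 (hmem i), γ i,
      fun k => Part.eq_some_iff.2 (mem_run.2 (he (i, k))), rfl⟩
  · let ι := {p : (PObj OscType × PObj TransType) × Set ℝ //
      IsOscComplementR2 p.1.1 ∧ IsR2ToR3 p.1.2 ∧ p.2.Finite}
    let A : List (ι → Arg) := [fun i => .ofObj .set (charFun i.1.2),
      fun _ => .ofObj (.arrow .one .zero) existsTwo, fun i => .fn _ _ i.1.1.1,
      fun i => .fn _ _ i.1.1.2]
    have : HasE A := ⟨by simp [A]⟩
    have hXA : (fun i : ι => Arg.ofObj .set (charFun i.1.2)) ∈ A := by simp [A]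
    obtain ⟨ζ, hζ, hcov⟩ := exists_cptS_covering (A := A) (Γ := fun i => i.1.1.1)
      (Δ := fun i => i.1.1.2) (X := fun i => i.1.2) (by simp [A]) (by simp [A])
      (fun i => i.2.1) (fun i => i.2.2.1) hXA (fun i => i.2.2.2)
    obtain ⟨γ, ⟨d, hd⟩, hγ⟩ := exists_cptS_enumeration hXA (fun i => i.2.2.2) hζ hcov
    refine ⟨d, fun Γ Δ hΓ hΔ X hX => ?_⟩
    let i : ι := ⟨((Γ, Δ), X), hΓ, hΔ, hX⟩
    exact ⟨γ i, fun k => Part.eq_some_iff.2 (mem_run.2 (hd (i, k))), hγ i⟩
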